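/- Let $\mathbb{D}=\{z\in\mathbb{C}:|z|<1\}$, $\alpha\ge 0$ and $0\le\beta<1$. Let $\mathcal{W}_{\mathcal H}^0(\alpha,\beta)$ be the class of complex-valued harmonic functions $f$ in $\mathbb{D}$ with $f(0)=0$, $f_z(0)=1$, $f_{\bar z}(0)=0$ such that, writing $f=h+\overline{g}$ with $h,g$ analytic in $\mathbb{D}$ and $h(0)=g(0)=0$, $$\operatorname{Re}\bigl(h'(z)+\alpha z h''(z)-\beta\bigr)>\bigl|g'(z)+\alpha z g''(z)\bigr|\qquad(z\in\mathbb{D}).$$ For $f=h+\overline g$ in this class with $h(z)=\sum_{k\ge1}a_kz^k$ (so $a_1=1$) and $g(z)=\sum_{k\ge1}b_kz^k$ (so $b_1=0$), and integers $p,q\ge1$, let $$s_{p,q}(f)(z)=\sum_{k=1}^{p}a_kz^k+\overline{\sum_{k=1}^{q}b_kz^k}.$$ If $1=p<q$, or $3\le p<q$, or $3\le q<p$, then $s_{p,q}(f)$ is convex in the disc $|z|<1/4$; that is, it is univalent in $|z|<1/4$ and, for every $0<r\le 1/4$, the image of the disc $|z|<r$ under $s_{p,q}(f)$ is a convex set.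 -/

import Mathlib

open scoped ComplexConjugate

namespace HarmonicMap

/-- The open unit disc. -/
def unitDisc : Set ℂ := Metric.ball (0 : ℂ) 1

/-- The Wirtinger derivative `∂f/∂z`. -/
noncomputable def wirtinger (f : ℂ → ℂ) (z : ℂ) : ℂ :=
  (fderiv ℝ f z 1 - Complex.I * fderiv ℝ f z Complex.I) / 2

/-- The Wirtinger derivative `∂f/∂z̄`. -/
noncomputable def wirtingerBar (f : ℂ → ℂ) (z : ℂ) : ℂ :=
  (fderiv ℝ f z 1 + Complex.I * fderiv ℝ f z Complex.I) / 2

/-- The class of complex valued harmonic functions in the unit disc with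
`f(0) = 0`, `f_z(0) = 1`. -/
def classH : Set (ℂ → ℂ) :=
  {f | InnerProductSpace.HarmonicOnNhd f unitDisc ∧ f 0 = 0 ∧ wirtinger f 0 = 1}

/-- The subclass of `classH` of functions with `f_z̄(0) = 0`. -/
def classH0 : Set (ℂ → ℂ) :=
  {f | f ∈ classH ∧ wirtingerBar f 0 = 0}

/-- `f = h + conj g` in the unit disc, where `h` and `g` are analytic there and vanish at `0`.
For a harmonic `f` with `f(0) = 0` this determines `h` and `g` uniquely in the unit disc. -/
structure IsCanonicalDecomposition (f h g : ℂ → ℂ) : Prop where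
  analytic_h : DifferentiableOn ℂ h unitDisc
  analytic_g : DifferentiableOn ℂ g unitDisc
  h_zero : h 0 = 0
  g_zero : g 0 = 0
  eq_add_conj : ∀ z ∈ unitDisc, f z = h z + conj (g z)

/-- The class of those `f = h + conj g` in `classH0` for which
`Re (h'(z) + α z h''(z) - β) > |g'(z) + α z g''(z)|` in the unit disc. -/
def classWH0 (α β : ℝ) : Set (ℂ → ℂ) :=
  {f | f ∈ classH0 ∧ ∃ h g : ℂ → ℂ, IsCanonicalDecomposition f h g ∧
    ∀ z ∈ unitDisc,
      ‖deriv g z + (α : ℂ) * z * deriv (deriv g) z‖ <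
        (deriv h z + (α : ℂ) * z * deriv (deriv h) z - (β : ℂ)).re}

/-- The `n`-th Taylor coefficient at `0`. -/
noncomputable def taylorCoeff (h : ℂ → ℂ) (n : ℕ) : ℂ :=
  iteratedDeriv n h 0 / (n.factorial : ℂ)

/-- The section `∑_{k=1}^{p} a_k z^k` of an analytic function `h(z) = ∑_{k≥1} a_k z^k`. -/
noncomputable def analyticSection (p : ℕ) (h : ℂ → ℂ) (z : ℂ) : ℂ :=
  ∑ k ∈ Finset.Icc 1 p, taylorCoeff h k * z ^ k

/-- The `(p,q)`-th partial sum `s_p(h) + conj (s_q(g))` of `h + conj g`. -/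
noncomputable def partialSum (p q : ℕ) (h g : ℂ → ℂ) (z : ℂ) : ℂ :=
  analyticSection p h z + conj (analyticSection q g z)

/-- `F` is convex in the disc `|z| < R`: it is univalent there, and it maps the disc `|z| < R`
(`r = R`), as well as every smaller concentric disc, onto a convex set. For harmonic maps the
convexity of the image of a disc is not inherited by smaller concentric discs, so it is
demanded for all of them. -/
def IsConvexInDisc (F : ℂ → ℂ) (R : ℝ) : Prop :=
  Set.InjOn F (Metric.ball (0 : ℂ) R) ∧
    ∀ r : ℝ, 0 < r → r ≤ R → Convex ℝ (F '' Metric.ball (0 : ℂ) r)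

end HarmonicMap

/-! Write `H` and `G` for the two sections. For `‖ε‖ ≤ 1` put `φ = h' + ε g'`. The defining
inequality and `β ≥ 0` make `Re (φ + α z φ')` positive, hence `Re φ > 0`, with `φ 0 = 1`.
Carathéodory's bound then limits the coefficients of `h'` and of `h' + ε g'` to `2`, and domination
by `Re h'` limits those of `g'` to `1`. For `‖z‖ ≤ 1/4`, Harnack gives `Re φ ≥ 3/5` and Schwarz–Pick
gives `‖z φ'‖ ≤ (8/15) Re φ`. Tails starting at degree three are too small to spoil these bounds, so
`Re (H' + ε G') > 0` and `‖z (H'' + ε G'')‖ < ‖H' + ε G'‖`. When `p = 1`, `H' = 1` and geometric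
series suffice (`section_bounds_of_three_le`, `section_bounds_of_one`).

It remains to pass from this curvature inequality, which says that each analytic `H + ε G` is
convex, to the harmonic map `F = H + conj G` (`isConvexInDisc_add_conj`). Univalence follows from
`‖G'‖ < Re H'`. If a curve `γ` is mapped by `F` affinely onto a piece of a line, differentiating
twice and choosing `ε` well gives `‖γ‖ ‖γ''‖ < ‖γ'‖²`. So `‖γ‖²` has positive second derivative and
no local maximum. Hence a segment joining two points of `F (closedBall 0 ρ)`, once known to lie in a
slightly larger image, lies in `F (closedBall 0 ρ)`. A continuity argument in the radius removes the
proviso. -/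

namespace HarmonicMap

open Filter Topology Metric Set

/-! ### Curvature inequality -/

/-- A real function whose second derivative is positive at a point has no local maximum there. -/
theorem not_isLocalMax_of_hasDerivAt_pos {n n' : ℝ → ℝ} {c : ℝ}
    (h1 : ∀ᶠ s in 𝓝 0, HasDerivAt n (n' s) s) (h2 : HasDerivAt n' c 0) (hc : 0 < c) :
    ¬ IsLocalMax n 0 := by
  intro hmax
  have hev : deriv n =ᶠ[𝓝 0] n' := h1.mono fun s hs => hs.deriv
  have h0 : deriv n 0 = 0 := hmax.deriv_eq_zero
  have hdd : deriv (deriv n) 0 = c := by rw [hev.deriv_eq, h2.deriv]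
  have hmin : IsLocalMin n 0 :=
    isLocalMin_of_deriv_deriv_pos (by rw [hdd]; exact hc) h0 h1.self_of_nhds.continuousAt
  -- Being a local maximum and a local minimum forces local constancy, hence a zero second
  -- derivative.
  have hconst : n =ᶠ[𝓝 0] fun _ => n 0 := by
    filter_upwards [hmax, hmin] with s hs hs' using le_antisymm hs hs'
  have : deriv (deriv n) 0 = 0 := by
    rw [(hconst.deriv).deriv_eq]; simp
  linarith [hdd, this]

/-- The pointwise inequality behind the convexity of the image. -/
theorem norm_mul_lt_sq_of_curvature {z a b a₂ b₂ v w : ℂ} (hv : v ≠ 0)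
    (hc : ∀ ε : ℂ, ‖ε‖ = 1 → ‖z * (a₂ + ε * b₂)‖ < ‖a + ε * b‖)
    (he : a * w + a₂ * v ^ 2 + conj (b * w + b₂ * v ^ 2) = 0) :
    ‖z‖ * ‖w‖ < ‖v‖ ^ 2 := by
  -- Since `conj l * (b * w)` and `l * conj (b * w)` have opposite imaginary parts, the imaginary
  -- part to kill is that of `l * D` with `D = a * w - conj (b * w)`; rotate `D` onto the positive
  -- axis.
  obtain ⟨l, hl, hreal⟩ : ∃ l : ℂ, ‖l‖ = 1 ∧ (l * (a * w) + conj l * (b * w)).im = 0 := by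
    rcases eq_or_ne (a * w - conj (b * w)) 0 with hD | hD
    · refine ⟨1, by simp, ?_⟩
      have := congrArg Complex.im hD
      rw [Complex.sub_im, Complex.conj_im, Complex.zero_im] at this
      simp only [map_one, one_mul, Complex.add_im]
      linarith
    · refine ⟨conj (a * w - conj (b * w)) / ‖a * w - conj (b * w)‖, ?_, ?_⟩
      · rw [norm_div, RCLike.norm_conj, Complex.norm_real, norm_norm, div_self (norm_ne_zero_iff.2 hD)]
      · set D := a * w - conj (b * w) with hDdef
        have h1 : (conj D / (‖D‖ : ℂ) * (a * w) + conj (conj D / (‖D‖ : ℂ)) * (b * w)).im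
            = (conj D / (‖D‖ : ℂ) * D).im := by
          have : a * w = D + conj (b * w) := by rw [hDdef]; ring
          rw [this]
          simp only [map_div₀, Complex.conj_conj, Complex.conj_ofReal]
          have e : conj D / (‖D‖ : ℂ) * (D + conj (b * w)) + D / (‖D‖ : ℂ) * (b * w)
              = conj D / (‖D‖ : ℂ) * D + (conj (D / (‖D‖ : ℂ) * (b * w)) + D / (‖D‖ : ℂ) * (b * w)) := by
            simp only [map_mul, map_div₀, Complex.conj_ofReal]; ring
          rw [e, Complex.add_im, Complex.add_im, Complex.conj_im]; ring
        rw [h1]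
        have : conj D / (‖D‖ : ℂ) * D = ((‖D‖ : ℝ) : ℂ) := by
          have hD0 : (‖D‖ : ℂ) ≠ 0 := by simpa using hD
          field_simp
          rw [mul_comm, Complex.mul_conj, Complex.normSq_eq_norm_sq]; push_cast; ring
        rw [this, Complex.ofReal_im]
  have hll : l * conj l = 1 := by
    rw [Complex.mul_conj, Complex.normSq_eq_norm_sq, hl]; simp
  -- With this choice `l * (a + ε * b) = l * a + conj l * b`, the combination made real above.
  set ε := conj l ^ 2 with hε
  have hεn : ‖ε‖ = 1 := by rw [hε, norm_pow, RCLike.norm_conj, hl]; simp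
  have hlt := hc ε hεn
  have hX : l * w * (a + ε * b) = l * (a * w) + conj l * (b * w) := by
    rw [hε]; linear_combination (w * b * conj l) * hll
  have hY : l * v ^ 2 * (a₂ + ε * b₂) = l * (a₂ * v ^ 2) + conj l * (b₂ * v ^ 2) := by
    rw [hε]; linear_combination (v ^ 2 * b₂ * conj l) * hll
  have hre : (l * (a * w) + conj l * (b * w)).re = -(l * (a₂ * v ^ 2) + conj l * (b₂ * v ^ 2)).re := by
    have h2 : (l * (a * w + a₂ * v ^ 2 + conj (b * w + b₂ * v ^ 2))).re = 0 := by rw [he]; simp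
    have h3 : (conj l * (b * w + b₂ * v ^ 2)).re = (l * conj (b * w + b₂ * v ^ 2)).re := by
      rw [← Complex.conj_re (l * conj (b * w + b₂ * v ^ 2))]; simp
    have h4 : (l * (a * w) + conj l * (b * w)) + (l * (a₂ * v ^ 2) + conj l * (b₂ * v ^ 2))
        = l * (a * w + a₂ * v ^ 2) + conj l * (b * w + b₂ * v ^ 2) := by ring
    have h5 := congrArg Complex.re h4
    rw [mul_add, Complex.add_re] at h2
    rw [Complex.add_re, Complex.add_re (l * (a * w + a₂ * v ^ 2)), h3] at h5
    linarith
  -- The `w`-term is real, so its norm is the absolute value of its real part, which by `hre` is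
  -- that of the `v ^ 2`-term.
  have h6 : ‖w‖ * ‖a + ε * b‖ ≤ ‖v‖ ^ 2 * ‖a₂ + ε * b₂‖ := by
    have e1 : ‖w‖ * ‖a + ε * b‖ = ‖l * w * (a + ε * b)‖ := by simp [hl]
    have e2 : ‖v‖ ^ 2 * ‖a₂ + ε * b₂‖ = ‖l * v ^ 2 * (a₂ + ε * b₂)‖ := by simp [hl]
    rw [e1, e2, hX, hY]
    have : l * (a * w) + conj l * (b * w)
        = ((l * (a * w) + conj l * (b * w)).re : ℂ) := by
      exact Complex.ext (Complex.ofReal_re _).symm (hreal.trans (Complex.ofReal_im _).symm)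
    rw [this, Complex.norm_real, hre, norm_neg]
    exact Complex.abs_re_le_norm _
  have hpos : 0 < ‖a + ε * b‖ := (norm_nonneg _).trans_lt hlt
  have hv2 : 0 < ‖v‖ ^ 2 := by positivity
  rw [norm_mul] at hlt
  by_contra! hcon
  have := calc ‖v‖ ^ 2 * ‖a + ε * b‖ ≤ ‖z‖ * ‖w‖ * ‖a + ε * b‖ := by gcongr
    _ = ‖z‖ * (‖w‖ * ‖a + ε * b‖) := by ring
    _ ≤ ‖z‖ * (‖v‖ ^ 2 * ‖a₂ + ε * b₂‖) := by gcongr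
    _ = ‖v‖ ^ 2 * (‖z‖ * ‖a₂ + ε * b₂‖) := by ring
    _ < ‖v‖ ^ 2 * ‖a + ε * b‖ := by gcongr
  exact lt_irrefl _ this

/-! ### Calculus of `H + conj G` along curves -/

/-- The real derivative `v ↦ a v + conj (b v)` of `H + conj G`. -/
noncomputable def realDeriv (a b : ℂ) : ℂ →L[ℝ] ℂ :=
  (a • (1 : ℂ →L[ℂ] ℂ)).restrictScalars ℝ +
    (Complex.conjCLE : ℂ →L[ℝ] ℂ).comp ((b • (1 : ℂ →L[ℂ] ℂ)).restrictScalars ℝ)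

@[simp] theorem realDeriv_apply (a b v : ℂ) : realDeriv a b v = a * v + conj (b * v) := by
  simp [realDeriv]

theorem realDeriv_injective {a b : ℂ} (hab : ‖b‖ < ‖a‖) :
    Function.Injective (realDeriv a b) := by
  rw [injective_iff_map_eq_zero]
  intro v hv
  by_contra hv0
  rw [realDeriv_apply] at hv
  have h := congrArg norm (eq_neg_of_add_eq_zero_left hv)
  rw [norm_neg, RCLike.norm_conj, norm_mul, norm_mul] at h
  have : 0 < ‖v‖ := by positivity
  have := mul_right_cancel₀ this.ne' h
  linarith

/-- The real derivative of a sense preserving harmonic map, as an isomorphism. -/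
noncomputable def realDerivEquiv {a b : ℂ} (hab : ‖b‖ < ‖a‖) : ℂ ≃L[ℝ] ℂ :=
  (LinearEquiv.ofInjectiveEndo (realDeriv a b : ℂ →ₗ[ℝ] ℂ)
    (realDeriv_injective hab)).toContinuousLinearEquiv

theorem coe_realDerivEquiv {a b : ℂ} (hab : ‖b‖ < ‖a‖) :
    (realDerivEquiv hab : ℂ →L[ℝ] ℂ) = realDeriv a b := by
  ext v
  rfl

theorem hasFDerivAt_add_conj {H G : ℂ → ℂ} {z a b : ℂ} (hH : HasDerivAt H a z)
    (hG : HasDerivAt G b z) :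
    HasFDerivAt (fun z => H z + conj (G z)) (realDeriv a b) z := by
  have h1 := hH.hasFDerivAt.restrictScalars ℝ
  have h2 := hG.hasFDerivAt.restrictScalars ℝ
  have h3 := h1.add ((Complex.conjCLE : ℂ →L[ℝ] ℂ).hasFDerivAt.comp z h2)
  refine h3.congr_fderiv ?_
  ext v
  simp [mul_comm]

theorem contDiff_add_conj {H G : ℂ → ℂ} (hH : Differentiable ℂ H) (hG : Differentiable ℂ G) :
    ContDiff ℝ 2 fun z => H z + conj (G z) := by
  have h1 : ContDiff ℝ 2 H := (hH.contDiff (n := 2)).restrict_scalars ℝ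
  have h2 : ContDiff ℝ 2 G := (hG.contDiff (n := 2)).restrict_scalars ℝ
  exact h1.add (Complex.conjCLE.contDiff.comp h2)

/-- The derivative of `A γ * v + conj (B γ * v)` along a curve `γ`. -/
theorem hasDerivAt_mul_add_conj {A B : ℂ → ℂ} {a b : ℂ} {γ v : ℝ → ℂ} {γ' v' : ℂ} {s : ℝ}
    (hA : HasDerivAt A a (γ s)) (hB : HasDerivAt B b (γ s)) (hγ : HasDerivAt γ γ' s)
    (hv : HasDerivAt v v' s) :
    HasDerivAt (fun t => A (γ t) * v t + conj (B (γ t) * v t))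
      (A (γ s) * v' + a * γ' * v s + conj (B (γ s) * v' + b * γ' * v s)) s := by
  have h1 := (hA.comp_of_eq s hγ rfl).mul hv
  have h2 := (hB.comp_of_eq s hγ rfl).mul hv
  have h3 := h1.add ((Complex.conjCLE : ℂ →L[ℝ] ℂ).hasFDerivAt.comp_hasDerivAt s h2)
  refine h3.congr_deriv ?_
  simp only [Function.comp_apply, ContinuousLinearEquiv.coe_coe, Complex.conjCLE_apply, map_add,
    map_mul]
  ring

theorem hasDerivAt_normSq_comp {γ : ℝ → ℂ} {γ' : ℂ} {s : ℝ} (hγ : HasDerivAt γ γ' s) :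
    HasDerivAt (fun t => ‖γ t‖ ^ 2) (2 * (conj (γ s) * γ').re) s := by
  convert hγ.norm_sq using 1
  simp [Complex.inner]
  ring

/-- Along the preimage of a line under `H + conj G` the modulus has no local maximum. -/
theorem not_isLocalMax_norm_sq_of_line {H G : ℂ → ℂ} (hH : Differentiable ℂ H)
    (hG : Differentiable ℂ G) {γ : ℝ → ℂ} (hγ : ContDiffAt ℝ 2 γ 0) {w d : ℂ} (hd : d ≠ 0)
    (hline : ∀ᶠ s : ℝ in 𝓝 0, H (γ s) + conj (G (γ s)) = w + s * d)
    (hcurv : ∀ ε : ℂ, ‖ε‖ = 1 →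
      ‖γ 0 * (deriv (deriv H) (γ 0) + ε * deriv (deriv G) (γ 0))‖ <
        ‖deriv H (γ 0) + ε * deriv G (γ 0)‖) :
    ¬ IsLocalMax (fun s => ‖γ s‖ ^ 2) 0 := by
  have hH' : Differentiable ℂ (deriv H) := by
    have := hH.contDiff (n := 2)
    exact ((contDiff_succ_iff_deriv (n := 1)).1 this).2.2.differentiable (by simp)
  have hG' : Differentiable ℂ (deriv G) := by
    have := hG.contDiff (n := 2)
    exact ((contDiff_succ_iff_deriv (n := 1)).1 this).2.2.differentiable (by simp)
  have hγev : ∀ᶠ s in 𝓝 (0 : ℝ), HasDerivAt γ (deriv γ s) s := by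
    filter_upwards [hγ.eventually (by simp)] with s hs
    exact (hs.differentiableAt (by simp)).hasDerivAt
  have hγ1 : HasDerivAt (deriv γ) (deriv (deriv γ) 0) 0 := by
    have : ContDiffAt ℝ 1 (deriv γ) 0 := by
      exact (hγ.fderiv_right (m := 1) (by norm_num)).clm_apply contDiffAt_const
    exact (this.differentiableAt (by simp)).hasDerivAt
  have hγ0 := hγev.self_of_nhds
  have hfirst : ∀ᶠ s in 𝓝 (0 : ℝ),
      deriv H (γ s) * deriv γ s + conj (deriv G (γ s) * deriv γ s) = d := by
    filter_upwards [hγev, hline.eventually_nhds] with s hs hl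
    have h1 := (hasFDerivAt_add_conj (hH (γ s)).hasDerivAt
      (hG (γ s)).hasDerivAt).comp_hasDerivAt s hs
    have h2 : HasDerivAt (fun s : ℝ => w + s * d) d s := by
      simpa using ((Complex.ofRealCLM.hasDerivAt (x := s)).mul_const d).const_add w
    have h3 := (h2.congr_of_eventuallyEq hl).unique h1
    rw [realDeriv_apply] at h3
    exact h3.symm
  have hsecond : deriv H (γ 0) * deriv (deriv γ) 0 + deriv (deriv H) (γ 0) * deriv γ 0 ^ 2 +
      conj (deriv G (γ 0) * deriv (deriv γ) 0 + deriv (deriv G) (γ 0) * deriv γ 0 ^ 2) = 0 := by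
    have h1 := hasDerivAt_mul_add_conj (hH' (γ 0)).hasDerivAt (hG' (γ 0)).hasDerivAt hγ0 hγ1
    have h2 := ((hasDerivAt_const (0 : ℝ) d).congr_of_eventuallyEq hfirst).unique h1
    rw [h2]; ring_nf
  have hne : deriv γ 0 ≠ 0 := by
    intro h0
    have := hfirst.self_of_nhds
    rw [h0] at this
    simp at this
    exact hd this.symm
  have key := norm_mul_lt_sq_of_curvature hne hcurv hsecond
  -- The second derivative of `‖γ‖ ^ 2` is `2 (‖γ'‖ ^ 2 + Re (conj γ * γ''))`, positive by `key`.
  refine not_isLocalMax_of_hasDerivAt_pos (n' := fun s => 2 * (conj (γ s) * deriv γ s).re)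
    (c := 2 * (‖deriv γ 0‖ ^ 2 + (conj (γ 0) * deriv (deriv γ) 0).re))
    (hγev.mono fun s hs => hasDerivAt_normSq_comp hs) ?_ ?_
  · have h1 := ((Complex.conjCLE : ℂ →L[ℝ] ℂ).hasFDerivAt.comp_hasDerivAt (0 : ℝ) hγ0).mul hγ1
    have h2 := (Complex.reCLM.hasFDerivAt.comp_hasDerivAt (0 : ℝ) h1).const_mul 2
    refine h2.congr_deriv ?_
    have : conj (deriv γ 0) * deriv γ 0 = ((‖deriv γ 0‖ ^ 2 : ℝ) : ℂ) := by
      rw [mul_comm, Complex.mul_conj, Complex.normSq_eq_norm_sq]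
    simp [-Complex.mul_re, this]
    norm_cast
  · have h1 : -(‖γ 0‖ * ‖deriv (deriv γ) 0‖) ≤ (conj (γ 0) * deriv (deriv γ) 0).re := by
      have := Complex.abs_re_le_norm (conj (γ 0) * deriv (deriv γ) 0)
      rw [norm_mul, RCLike.norm_conj] at this
      exact (abs_le.1 this).1
    linarith

/-! ### Univalence and convexity of the images -/

/-- A harmonic map `H + conj G` with `‖G'‖ < Re H'` in a disc is univalent there. -/
theorem injOn_add_conj {H G : ℂ → ℂ} (hH : Differentiable ℂ H) (hG : Differentiable ℂ G) {R : ℝ}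
    (hre : ∀ z ∈ ball (0 : ℂ) R, ‖deriv G z‖ < (deriv H z).re) :
    InjOn (fun z => H z + conj (G z)) (ball 0 R) := by
  intro x hx y hy hxy
  by_contra hne
  set d := y - x with hd
  have hd0 : d ≠ 0 := sub_ne_zero.2 (Ne.symm hne)
  -- Rolle argument: the derivative of `φ` is at least `‖d‖ ^ 2 * (Re H' - ‖G'‖) > 0`, yet `φ 0 = φ
  -- 1`.
  set φ : ℝ → ℝ := fun t => (conj d * (H (x + t * d) + conj (G (x + t * d)))).re with hφ
  have hline : ∀ t : ℝ, HasDerivAt (fun t : ℝ => x + t * d) d t := fun t => by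
    simpa using ((Complex.ofRealCLM.hasDerivAt (x := t)).mul_const d).const_add x
  have hder : ∀ t : ℝ, HasDerivAt φ (conj d * (deriv H (x + t * d) * d +
      conj (deriv G (x + t * d) * d))).re t := fun t => by
    have h1 := ((hasFDerivAt_add_conj (hH (x + t * d)).hasDerivAt
      (hG (x + t * d)).hasDerivAt).comp_hasDerivAt t (hline t)).const_mul (conj d)
    have h2 := Complex.reCLM.hasFDerivAt.comp_hasDerivAt t h1
    refine h2.congr_deriv ?_
    rw [realDeriv_apply]; rfl
  obtain ⟨t, ht, hs⟩ := exists_hasDerivAt_eq_slope φ _ zero_lt_one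
    (fun t _ => (hder t).continuousAt.continuousWithinAt) (fun t _ => hder t)
  have h0 : φ 1 - φ 0 = 0 := by
    have e : x + (1 : ℝ) * d = y := by rw [hd]; push_cast; ring
    simp only [hφ, e]
    simp only at hxy
    rw [← hxy]; simp
  rw [h0, zero_div] at hs
  have hmem : x + t * d ∈ ball (0 : ℂ) R := by
    have := (convex_ball (0 : ℂ) R).add_smul_sub_mem hx hy ⟨ht.1.le, ht.2.le⟩
    simpa [hd] using this
  have hlt := hre _ hmem
  set a := deriv H (x + t * d)
  set b := deriv G (x + t * d)
  have e1 : conj d * (a * d) = ((‖d‖ ^ 2 : ℝ) : ℂ) * a := by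
    have : conj d * d = ((‖d‖ ^ 2 : ℝ) : ℂ) := by
      rw [mul_comm, Complex.mul_conj, Complex.normSq_eq_norm_sq]
    rw [← this]; ring
  have e2 : -(‖d‖ ^ 2 * ‖b‖) ≤ (conj d * conj (b * d)).re := by
    have := (abs_le.1 (Complex.abs_re_le_norm (conj d * conj (b * d)))).1
    simp only [norm_mul, RCLike.norm_conj] at this
    linarith
  rw [mul_add, Complex.add_re, e1, Complex.re_ofReal_mul] at hs
  have : 0 < ‖d‖ ^ 2 := by positivity
  nlinarith

section Convexity

variable {H G : ℂ → ℂ} {R : ℝ}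

/-- Inverse function theorem, in class `C²` because preimages of lines are differentiated twice. -/
theorem exists_localInverse (hH : Differentiable ℂ H) (hG : Differentiable ℂ G) {z : ℂ}
    (hz : ‖deriv G z‖ < ‖deriv H z‖) :
    ∃ ℓ : ℂ → ℂ, ContDiffAt ℝ 2 ℓ (H z + conj (G z)) ∧ ℓ (H z + conj (G z)) = z ∧
      ∀ᶠ w in 𝓝 (H z + conj (G z)), H (ℓ w) + conj (G (ℓ w)) = w := by
  have hc := (contDiff_add_conj hH hG).contDiffAt (x := z)
  have hd : HasFDerivAt (fun z => H z + conj (G z)) (realDerivEquiv hz : ℂ →L[ℝ] ℂ) z := by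
    rw [coe_realDerivEquiv]
    exact hasFDerivAt_add_conj (hH z).hasDerivAt (hG z).hasDerivAt
  have h2 : (2 : WithTop ℕ∞) ≠ 0 := by simp
  exact ⟨hc.localInverse hd h2, hc.to_localInverse hd h2, hc.localInverse_apply_image hd h2,
    (hc.hasStrictFDerivAt' hd h2).eventually_right_inverse⟩

theorem isOpen_image_ball (hH : Differentiable ℂ H) (hG : Differentiable ℂ G)
    (hre : ∀ z ∈ ball (0 : ℂ) R, ‖deriv G z‖ < ‖deriv H z‖) {r : ℝ} (hr : r ≤ R) :
    IsOpen ((fun z => H z + conj (G z)) '' ball (0 : ℂ) r) := by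
  rw [isOpen_iff_mem_nhds]
  rintro _ ⟨z, hz, rfl⟩
  have hlt := hre z (ball_subset_ball hr hz)
  have hd : HasFDerivAt (fun z => H z + conj (G z)) (realDerivEquiv hlt : ℂ →L[ℝ] ℂ) z := by
    rw [coe_realDerivEquiv]
    exact hasFDerivAt_add_conj (hH z).hasDerivAt (hG z).hasDerivAt
  have := ((contDiff_add_conj hH hG).contDiffAt.hasStrictFDerivAt' hd
    (by simp)).map_nhds_eq_of_equiv
  rw [← this]
  exact image_mem_map (isOpen_ball.mem_nhds hz)

/-- Maximum principle for the modulus on the preimage of a segment. -/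
theorem segment_subset_image_closedBall (hH : Differentiable ℂ H) (hG : Differentiable ℂ G)
    (hre : ∀ z ∈ ball (0 : ℂ) R, ‖deriv G z‖ < (deriv H z).re)
    (hcurv : ∀ z ∈ ball (0 : ℂ) R, ∀ ε : ℂ, ‖ε‖ = 1 →
      ‖z * (deriv (deriv H) z + ε * deriv (deriv G) z)‖ < ‖deriv H z + ε * deriv G z‖)
    {ρ r : ℝ} (hρ : ρ < r) (hr : r < R) {a b : ℂ} (ha : ‖a‖ ≤ ρ) (hb : ‖b‖ ≤ ρ)
    (hseg : segment ℝ (H a + conj (G a)) (H b + conj (G b)) ⊆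
      (fun z => H z + conj (G z)) '' ball (0 : ℂ) r) :
    segment ℝ (H a + conj (G a)) (H b + conj (G b)) ⊆
      (fun z => H z + conj (G z)) '' closedBall (0 : ℂ) ρ := by
  have hinj := injOn_add_conj hH hG hre
  have hcont : Continuous fun z => H z + conj (G z) := (contDiff_add_conj hH hG).continuous
  set F : ℂ → ℂ := fun z => H z + conj (G z) with hF
  change segment ℝ (F a) (F b) ⊆ F '' ball (0 : ℂ) r at hseg
  change segment ℝ (F a) (F b) ⊆ F '' closedBall (0 : ℂ) ρ
  have hsub : ball (0 : ℂ) r ⊆ ball 0 R := ball_subset_ball hr.le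
  have haR : a ∈ ball (0 : ℂ) R := by rw [mem_ball_zero_iff]; linarith
  have hbR : b ∈ ball (0 : ℂ) R := by rw [mem_ball_zero_iff]; linarith
  have hclosed : IsClosed (segment ℝ (F a) (F b)) := by
    rw [segment_eq_image_lineMap]
    exact (isCompact_Icc.image (AffineMap.lineMap_continuous)).isClosed
  -- The point of largest modulus in the preimage of the segment will turn out to lie in `closedBall
  -- 0 ρ`.
  set M : Set ℂ := closedBall (0 : ℂ) r ∩ F ⁻¹' segment ℝ (F a) (F b) with hM
  have hMc : IsCompact M := (isCompact_closedBall 0 r).inter_right (hclosed.preimage hcont)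
  have haM : a ∈ M := ⟨by rw [mem_closedBall_zero_iff]; linarith, left_mem_segment ℝ _ _⟩
  obtain ⟨z₀, hz₀, hmax⟩ := hMc.exists_isMaxOn ⟨a, haM⟩ continuous_norm.continuousOn
  rw [isMaxOn_iff] at hmax
  suffices hz : ‖z₀‖ ≤ ρ by
    intro w hw
    obtain ⟨y, hy, rfl⟩ := hseg hw
    exact ⟨y, mem_closedBall_zero_iff.2 ((hmax y ⟨ball_subset_closedBall hy, hw⟩).trans hz), rfl⟩
  by_contra! hz
  obtain ⟨y, hy, hyz⟩ := hseg hz₀.2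
  have hz₀R : z₀ ∈ ball (0 : ℂ) R := by
    have := mem_closedBall_zero_iff.1 hz₀.1
    rw [mem_ball_zero_iff]; linarith
  -- Injectivity places `z₀` strictly inside the ball, so the lifted line through it stays in `M`
  -- for small parameters.
  have hz₀r : z₀ ∈ ball (0 : ℂ) r := hinj (hsub hy) hz₀R hyz ▸ hy
  have hna : F a ≠ F z₀ := fun h => by
    rw [hinj haR hz₀R h] at ha; linarith
  have hnb : F b ≠ F z₀ := fun h => by
    rw [hinj hbR hz₀R h] at hb; linarith
  have hopen := mem_openSegment_of_ne_left_right hna hnb hz₀.2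
  have hlt : ‖deriv G z₀‖ < ‖deriv H z₀‖ :=
    (hre z₀ hz₀R).trans_le ((le_abs_self _).trans (Complex.abs_re_le_norm _))
  obtain ⟨ℓ, hℓ, hℓ0, hℓF⟩ := exists_localInverse hH hG hlt
  change ContDiffAt ℝ 2 ℓ (F z₀) at hℓ
  change ℓ (F z₀) = z₀ at hℓ0
  change ∀ᶠ w in 𝓝 (F z₀), F (ℓ w) = w at hℓF
  rw [openSegment_eq_image_lineMap] at hopen
  obtain ⟨τ, hτ, hτz⟩ := hopen
  have hd : F b - F a ≠ 0 := by
    intro h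
    rw [sub_eq_zero] at h
    rw [h, AffineMap.lineMap_same] at hτz
    exact hna hτz
  set L : ℝ → ℂ := fun s => F z₀ + s * (F b - F a) with hL
  have hL0 : L 0 = F z₀ := by simp [hL]
  have hLc : ContDiff ℝ 2 L :=
    contDiff_const.add (Complex.ofRealCLM.contDiff.mul contDiff_const)
  have hLt : Tendsto L (𝓝 0) (𝓝 (F z₀)) := hL0 ▸ hLc.continuous.tendsto 0
  have hγ : ContDiffAt ℝ 2 (fun s => ℓ (L s)) 0 :=
    ContDiffAt.comp (0 : ℝ) (hL0.symm ▸ hℓ) hLc.contDiffAt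
  have hγ0 : ℓ (L 0) = z₀ := by rw [hL0, hℓ0]
  have hLseg : ∀ᶠ s in 𝓝 (0 : ℝ), L s ∈ segment ℝ (F a) (F b) := by
    have h1 : Tendsto (fun s : ℝ => τ + s) (𝓝 0) (𝓝 τ) := by
      have : Continuous fun s : ℝ => τ + s := by fun_prop
      simpa using this.tendsto 0
    filter_upwards [h1.eventually (Ioo_mem_nhds hτ.1 hτ.2)] with s hs
    rw [segment_eq_image_lineMap]
    refine ⟨τ + s, ⟨hs.1.le, hs.2.le⟩, ?_⟩
    simp only [hL, ← hτz, AffineMap.lineMap_apply, vsub_eq_sub, vadd_eq_add, Complex.real_smul]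
    push_cast; ring
  refine not_isLocalMax_norm_sq_of_line hH hG hγ (w := F z₀) hd
    (hLt.eventually hℓF) (by simpa only [hγ0] using hcurv z₀ hz₀R) ?_
  have hin : ∀ᶠ s in 𝓝 (0 : ℝ), ℓ (L s) ∈ ball (0 : ℂ) r := by
    have : Tendsto (fun s => ℓ (L s)) (𝓝 0) (𝓝 z₀) := by
      have := hγ.continuousAt.tendsto
      rwa [hγ0] at this
    exact this.eventually (isOpen_ball.mem_nhds hz₀r)
  filter_upwards [hin, hLt.eventually hℓF, hLseg] with s h1 h2 h3
  rw [hγ0]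
  have := hmax (ℓ (L s)) ⟨ball_subset_closedBall h1, by rw [mem_preimage, h2]; exact h3⟩
  gcongr

/-- Continuity method: shrink the endpoints to `t * x`, `t * y` and let `t` grow from `0` to `1`.
Openness of images keeps the segment in a slightly larger image, and the maximum principle pulls it
back to radius `t * ρ`. -/
theorem isConvexInDisc_add_conj (hH : Differentiable ℂ H) (hG : Differentiable ℂ G)
    (hre : ∀ z ∈ ball (0 : ℂ) R, ‖deriv G z‖ < (deriv H z).re)
    (hcurv : ∀ z ∈ ball (0 : ℂ) R, ∀ ε : ℂ, ‖ε‖ = 1 →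
      ‖z * (deriv (deriv H) z + ε * deriv (deriv G) z)‖ < ‖deriv H z + ε * deriv G z‖) :
    IsConvexInDisc (fun z => H z + conj (G z)) R := by
  refine ⟨injOn_add_conj hH hG hre, fun r hr hrR => ?_⟩
  have hcont : Continuous fun z => H z + conj (G z) := (contDiff_add_conj hH hG).continuous
  have hmaxp := fun {ρ r : ℝ} (hρ : ρ < r) (hr : r < R) {a b : ℂ} (ha : ‖a‖ ≤ ρ) (hb : ‖b‖ ≤ ρ) =>
    segment_subset_image_closedBall hH hG hre hcurv hρ hr ha hb
  have hopen : ∀ {r : ℝ}, r ≤ R → IsOpen ((fun z => H z + conj (G z)) '' ball (0 : ℂ) r) :=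
    isOpen_image_ball hH hG fun z hz =>
      (hre z hz).trans_le ((le_abs_self _).trans (Complex.abs_re_le_norm _))
  set F : ℂ → ℂ := fun z => H z + conj (G z) with hF
  rw [convex_iff_segment_subset]
  rintro _ ⟨x, hx, rfl⟩ _ ⟨y, hy, rfl⟩
  rw [mem_ball_zero_iff] at hx hy
  set ρ := max ‖x‖ ‖y‖ with hρ
  have hρr : ρ < r := max_lt hx hy
  have hρ0 : 0 ≤ ρ := (norm_nonneg x).trans (le_max_left _ _)
  set S : Set ℝ := {t | segment ℝ (F (t * x)) (F (t * y)) ⊆ F '' closedBall 0 (t * ρ)} with hS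
  have hsm : ∀ {t : ℝ} {z : ℂ}, 0 ≤ t → ‖z‖ ≤ ρ → ‖(t : ℂ) * z‖ ≤ t * ρ := fun {t z} ht hz => by
    rw [norm_mul, Complex.norm_real, Real.norm_of_nonneg ht]; gcongr
  have hclosed : IsClosed (S ∩ Icc 0 1) := by
    -- Rescaling preimages by `t * ρ` puts them in a fixed closed unit ball, so each condition on
    -- `t` is a projection of a compact set.
    have hrep : S ∩ Icc 0 1 = ⋂ σ ∈ Icc (0 : ℝ) 1, Prod.fst ''
        ((Icc (0 : ℝ) 1 ×ˢ closedBall (0 : ℂ) 1) ∩ {q : ℝ × ℂ |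
          F ((q.1 * ρ : ℝ) * q.2) = AffineMap.lineMap (F (q.1 * x)) (F (q.1 * y)) σ}) := by
      ext t
      simp only [mem_inter_iff, mem_iInter, hS, mem_ofPred_eq]
      constructor
      · rintro ⟨h, ht⟩ σ hσ
        have hm : AffineMap.lineMap (F (t * x)) (F (t * y)) σ ∈ segment ℝ (F (t * x)) (F (t * y)) := by
          rw [segment_eq_image_lineMap]; exact ⟨σ, hσ, rfl⟩
        obtain ⟨z, hz, hzF⟩ := h hm
        rw [mem_closedBall_zero_iff] at hz
        rcases eq_or_ne (t * ρ) 0 with h0 | h0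
        · rw [h0] at hz
          have hz0 : z = 0 := norm_le_zero_iff.1 hz
          refine ⟨(t, 0), ⟨⟨ht, by simp⟩, ?_⟩, rfl⟩
          simpa [hz0] using hzF
        · have hpos : 0 < t * ρ := lt_of_le_of_ne (mul_nonneg ht.1 hρ0) h0.symm
          refine ⟨(t, z / (t * ρ : ℝ)), ⟨⟨ht, ?_⟩, ?_⟩, rfl⟩
          · rw [mem_closedBall_zero_iff, norm_div, Complex.norm_real, Real.norm_of_nonneg hpos.le]
            exact (div_le_one hpos).2 hz
          · have hne : ((t * ρ : ℝ) : ℂ) ≠ 0 := by exact_mod_cast h0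
            simp only [mem_ofPred_eq]
            rw [mul_div_cancel₀ _ hne, hzF]
      · intro h
        have ht : t ∈ Icc (0 : ℝ) 1 := by
          obtain ⟨q, hq, rfl⟩ := h 0 (by simp)
          exact hq.1.1
        refine ⟨?_, ht⟩
        rw [segment_eq_image_lineMap]
        rintro _ ⟨σ, hσ, rfl⟩
        obtain ⟨⟨t', z⟩, hq, hq1⟩ := h σ hσ
        simp only at hq1
        subst hq1
        refine ⟨(t' * ρ : ℝ) * z, ?_, hq.2⟩
        have hz : ‖z‖ ≤ 1 := mem_closedBall_zero_iff.1 hq.1.2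
        have h0 : 0 ≤ t' * ρ := mul_nonneg ht.1 hρ0
        rw [mem_closedBall_zero_iff, norm_mul, Complex.norm_real, Real.norm_of_nonneg h0]
        nlinarith
    rw [hrep]
    refine isClosed_biInter fun σ _ => ?_
    refine (IsCompact.image ?_ continuous_fst).isClosed
    refine (isCompact_Icc.prod (isCompact_closedBall 0 1)).inter_right (isClosed_eq ?_ ?_)
    · exact hcont.comp (by fun_prop)
    · simp only [AffineMap.lineMap_apply, vsub_eq_sub, vadd_eq_add]
      have h1 : Continuous fun q : ℝ × ℂ => F (q.1 * x) := hcont.comp (by fun_prop)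
      have h2 : Continuous fun q : ℝ × ℂ => F (q.1 * y) := hcont.comp (by fun_prop)
      fun_prop
  have hall : Icc (0 : ℝ) 1 ⊆ S := by
    refine hclosed.Icc_subset_of_forall_exists_gt ?_ ?_
    · simp [hS]
    · rintro t ⟨htS, ht0, ht1⟩ t₁ ht₁
      have htρ : t * ρ < r := lt_of_le_of_lt (by nlinarith) hρr
      obtain ⟨r', hr'1, hr'2⟩ := exists_between htρ
      have hO := hopen (hr'2.le.trans hrR)
      have hseg : ∀ᶠ u : ℝ in 𝓝 t, segment ℝ (F (u * x)) (F (u * y)) ⊆ F '' ball 0 r' := by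
        have hK : ∀ᶠ u : ℝ in 𝓝 t, ∀ σ ∈ Icc (0 : ℝ) 1,
            AffineMap.lineMap (F (u * x)) (F (u * y)) σ ∈ F '' ball (0 : ℂ) r' := by
          refine isCompact_Icc.eventually_forall_of_forall_eventually fun σ hσ => ?_
          have hc : Continuous fun q : ℝ × ℝ =>
              AffineMap.lineMap (F (q.1 * x)) (F (q.1 * y)) q.2 := by
            simp only [AffineMap.lineMap_apply, vsub_eq_sub, vadd_eq_add]
            have h1 : Continuous fun q : ℝ × ℝ => F (q.1 * x) := hcont.comp (by fun_prop)
            have h2 : Continuous fun q : ℝ × ℝ => F (q.1 * y) := hcont.comp (by fun_prop)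
            fun_prop
          refine hc.continuousAt.eventually (hO.mem_nhds ?_)
          refine image_mono (closedBall_subset_ball hr'1) (htS ?_)
          rw [segment_eq_image_lineMap]; exact ⟨σ, hσ, rfl⟩
        filter_upwards [hK] with u hu
        rw [segment_eq_image_lineMap]
        rintro _ ⟨σ, hσ, rfl⟩
        exact hu σ hσ
      have hlt : ∀ᶠ u : ℝ in 𝓝 t, u * ρ < r' :=
        (continuous_id.mul continuous_const).continuousAt.eventually (Iio_mem_nhds hr'1)
      have hright : ∀ᶠ u : ℝ in 𝓝[>] t, u ∈ Ioc t t₁ := Ioc_mem_nhdsGT ht₁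
      obtain ⟨u, ⟨hu1, hu2⟩, hu3⟩ :=
        (((hseg.and hlt).filter_mono nhdsWithin_le_nhds).and hright).exists
      have hu0 : 0 ≤ u := ht0.trans hu3.1.le
      exact ⟨u, hmaxp hu2 (hr'2.trans_le hrR) (hsm hu0 (le_max_left _ _))
        (hsm hu0 (le_max_right _ _)) hu1, hu3⟩
  have h1 := hall (right_mem_Icc.2 zero_le_one)
  simp only [hS, mem_ofPred_eq, Complex.ofReal_one, one_mul] at h1
  exact h1.trans (image_mono (closedBall_subset_ball hρr))

end Convexity

/-! ### Coefficient bounds from circle averages -/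

theorem isOpen_unitDisc : IsOpen unitDisc := isOpen_ball

theorem norm_circleAverage_le {u : ℂ → ℂ} {v : ℂ → ℝ} {R : ℝ} (hv : CircleIntegrable v 0 R)
    (h : ∀ z ∈ sphere (0 : ℂ) |R|, ‖u z‖ ≤ v z) :
    ‖Real.circleAverage u 0 R‖ ≤ Real.circleAverage v 0 R := by
  rw [Real.circleAverage, Real.circleAverage, norm_smul, Real.norm_of_nonneg (by positivity),
    smul_eq_mul]
  gcongr
  exact intervalIntegral.norm_integral_le_of_norm_le (by positivity)
    (Eventually.of_forall fun θ _ => h _ (circleMap_mem_sphere' 0 R θ)) hv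

theorem diffContOnCl_of_unitDisc {f : ℂ → ℂ} (hf : DifferentiableOn ℂ f unitDisc) {ρ : ℝ}
    (h1 : ρ < 1) : DiffContOnCl ℂ f (ball 0 ρ) :=
  (hf.mono (closedBall_subset_ball h1)).diffContOnCl_ball subset_rfl

theorem continuousOn_sphere_of_unitDisc {f : ℂ → ℂ} (hf : DifferentiableOn ℂ f unitDisc) {ρ : ℝ}
    (h1 : ρ < 1) : ContinuousOn f (sphere 0 ρ) :=
  hf.continuousOn.mono (sphere_subset_closedBall.trans (closedBall_subset_ball h1))

theorem taylorCoeff_eq_circleAverage {f : ℂ → ℂ} (hf : DifferentiableOn ℂ f unitDisc) {ρ : ℝ}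
    (h0 : 0 < ρ) (h1 : ρ < 1) (k : ℕ) :
    taylorCoeff f k = Real.circleAverage (fun z => f z / z ^ k) 0 ρ := by
  have h := (diffContOnCl_of_unitDisc hf h1).circleIntegral_one_div_sub_center_pow_smul h0 k
  rw [Real.circleAverage_eq_circleIntegral h0.ne']
  have e : (fun z : ℂ => (z - 0)⁻¹ • (f z / z ^ k)) = fun z => (1 / (z - 0) ^ (k + 1)) • f z := by
    ext z
    simp only [sub_zero, smul_eq_mul, one_div, pow_succ, mul_inv]
    ring
  have hfac : (k.factorial : ℂ) ≠ 0 := by exact_mod_cast k.factorial_ne_zero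
  rw [e, h, taylorCoeff, smul_smul, smul_eq_mul]
  field_simp

theorem circleIntegrable_re {φ : ℂ → ℂ} (hφ : DifferentiableOn ℂ φ unitDisc) {ρ : ℝ}
    (h0 : 0 < ρ) (h1 : ρ < 1) (M : ℝ) : CircleIntegrable (fun z => M * (φ z).re) 0 ρ := by
  refine ContinuousOn.circleIntegrable h0.le ?_
  exact continuousOn_const.mul
    (Complex.continuous_re.comp_continuousOn (continuousOn_sphere_of_unitDisc hφ h1))

theorem circleAverage_mul_re {φ : ℂ → ℂ} (hφ : DifferentiableOn ℂ φ unitDisc) {ρ : ℝ}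
    (h0 : 0 < ρ) (h1 : ρ < 1) (M : ℝ) :
    Real.circleAverage (fun z => M * (φ z).re) 0 ρ = M * (φ 0).re := by
  have hi : CircleIntegrable φ 0 ρ :=
    (continuousOn_sphere_of_unitDisc hφ h1).circleIntegrable h0.le
  have h2 := Complex.reCLM.circleAverage_comp_comm hi
  have h3 : DiffContOnCl ℂ φ (ball 0 |ρ|) := by
    rw [abs_of_pos h0]; exact diffContOnCl_of_unitDisc hφ h1
  rw [h3.circleAverage] at h2
  have h4 := Real.circleAverage_fun_smul (a := M) (f := Complex.reCLM ∘ φ) (c := 0) (R := ρ)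
  simp only [smul_eq_mul] at h4
  rw [h2] at h4
  exact h4

theorem le_of_forall_mul_pow_le {c M : ℝ} {k : ℕ}
    (h : ∀ ρ : ℝ, 0 < ρ → ρ < 1 → c * ρ ^ k ≤ M) : c ≤ M := by
  have hc : Tendsto (fun ρ : ℝ => c * ρ ^ k) (𝓝[<] 1) (𝓝 c) := by
    have : Continuous fun ρ : ℝ => c * ρ ^ k := by fun_prop
    simpa using (this.tendsto 1).mono_left nhdsWithin_le_nhds
  refine le_of_tendsto hc ?_
  filter_upwards [Ioo_mem_nhdsLT zero_lt_one] with ρ hρ using h ρ hρ.1 hρ.2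

/-- The mean value property turns the average of `M * Re φ` into `M`; the factor `ρ ^ k` disappears
as `ρ → 1`. -/
theorem norm_le_of_eq_circleAverage {φ u : ℂ → ℂ} {c : ℂ} {k : ℕ} {M : ℝ}
    (hφ : DifferentiableOn ℂ φ unitDisc) (hφ0 : φ 0 = 1)
    (hc : ∀ ρ : ℝ, 0 < ρ → ρ < 1 → c = Real.circleAverage (fun z => u z / z ^ k) 0 ρ)
    (hu : ∀ z ∈ unitDisc, ‖u z‖ ≤ M * (φ z).re) : ‖c‖ ≤ M := by
  refine le_of_forall_mul_pow_le (k := k) fun ρ h0 h1 => ?_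
  have hle : ‖Real.circleAverage (fun z => u z / z ^ k) 0 ρ‖ ≤
      Real.circleAverage (fun z => (M / ρ ^ k) * (φ z).re) 0 ρ := by
    refine norm_circleAverage_le (circleIntegrable_re hφ h0 h1 _) fun z hz => ?_
    rw [abs_of_pos h0, mem_sphere_zero_iff_norm] at hz
    rw [norm_div, norm_pow, hz, div_mul_eq_mul_div]
    gcongr
    exact hu z (by rw [unitDisc, mem_ball_zero_iff, hz]; exact h1)
  rw [← hc ρ h0 h1, circleAverage_mul_re hφ h0 h1, hφ0, Complex.one_re, mul_one] at hle
  exact (le_div_iff₀ (by positivity)).1 hle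

/-- If `‖f‖ ≤ Re φ` in the unit disc and `φ 0 = 1`, the Taylor coefficients of `f` are bounded
by `1`. -/
theorem norm_taylorCoeff_le_one {f φ : ℂ → ℂ} (hf : DifferentiableOn ℂ f unitDisc)
    (hφ : DifferentiableOn ℂ φ unitDisc) (hφ0 : φ 0 = 1)
    (h : ∀ z ∈ unitDisc, ‖f z‖ ≤ (φ z).re) (k : ℕ) : ‖taylorCoeff f k‖ ≤ 1 :=
  norm_le_of_eq_circleAverage hφ hφ0
    (fun _ h0 h1 => taylorCoeff_eq_circleAverage hf h0 h1 k) (by simpa using h)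

/-- **Carathéodory's coefficient bound**. -/
theorem norm_taylorCoeff_le_two {φ : ℂ → ℂ} (hφ : DifferentiableOn ℂ φ unitDisc) (hφ0 : φ 0 = 1)
    (hre : ∀ z ∈ unitDisc, 0 < (φ z).re) {k : ℕ} (hk : k ≠ 0) : ‖taylorCoeff φ k‖ ≤ 2 := by
  -- Adding `conj φ` does not change the `k`-th coefficient for `k ≠ 0`, and it makes `u = 2 Re φ`,
  -- whence the constant `2`.
  refine norm_le_of_eq_circleAverage (u := fun z => φ z + conj (φ z)) hφ hφ0 (k := k) ?_ ?_
  · intro ρ h0 h1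
    have hz0 : ∀ z ∈ sphere (0 : ℂ) ρ, z ^ k ≠ 0 := fun z hz => by
      refine pow_ne_zero k fun h => ?_
      rw [mem_sphere_zero_iff_norm, h, norm_zero] at hz
      exact h0.ne hz
    have hcφ := continuousOn_sphere_of_unitDisc hφ h1
    have hcz : ContinuousOn (fun z : ℂ => z ^ k) (sphere 0 ρ) := by fun_prop
    have hmul : DifferentiableOn ℂ (fun z => φ z * z ^ k) unitDisc := hφ.mul (by fun_prop)
    have hi1 : CircleIntegrable (fun z => φ z / z ^ k) 0 ρ :=
      (hcφ.div hcz hz0).circleIntegrable h0.le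
    have hi2 : CircleIntegrable (fun z => conj (φ z) / z ^ k) 0 ρ :=
      ((Complex.continuous_conj.comp_continuousOn hcφ).div hcz hz0).circleIntegrable h0.le
    have hi3 : CircleIntegrable (fun z => φ z * z ^ k) 0 ρ :=
      (hcφ.mul hcz).circleIntegrable h0.le
    have hzero : Real.circleAverage (fun z => φ z * z ^ k) 0 ρ = 0 := by
      have : DiffContOnCl ℂ (fun z => φ z * z ^ k) (ball 0 |ρ|) := by
        rw [abs_of_pos h0]; exact diffContOnCl_of_unitDisc hmul h1
      rw [this.circleAverage]; simp [hk]
    -- On `‖z‖ = ρ` one has `1 / z ^ k = conj (z ^ k) / ρ ^ (2 * k)`, so this is a multiple of the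
    -- conjugate of `hzero`.
    have hconj : Real.circleAverage (fun z => conj (φ z) / z ^ k) 0 ρ = 0 := by
      have h2 := (Complex.conjCLE : ℂ →L[ℝ] ℂ).circleAverage_comp_comm hi3
      rw [hzero, map_zero] at h2
      have h3 := Real.circleAverage_fun_smul (a := (ρ ^ (2 * k))⁻¹) (E := ℂ)
        (f := (Complex.conjCLE : ℂ →L[ℝ] ℂ) ∘ fun z => φ z * z ^ k) (c := 0) (R := ρ)
      rw [h2, smul_zero] at h3
      refine Eq.trans ?_ h3
      apply Real.circleAverage_congr_sphere
      intro z hz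
      rw [abs_of_pos h0] at hz
      have hzn : z ^ k * conj (z ^ k) = ((ρ ^ (2 * k) : ℝ) : ℂ) := by
        rw [Complex.mul_conj, Complex.normSq_eq_norm_sq, norm_pow,
          mem_sphere_zero_iff_norm.1 hz, ← pow_mul, mul_comm]
      have hzk := hz0 z hz
      have hρ : ((ρ ^ (2 * k) : ℝ) : ℂ) ≠ 0 := by
        exact_mod_cast (pow_pos h0 _).ne'
      simp only [Function.comp_apply, ContinuousLinearEquiv.coe_coe, Complex.conjCLE_apply,
        map_mul, Complex.real_smul, Complex.ofReal_inv]
      rw [div_eq_iff hzk, mul_assoc, mul_assoc, mul_comm (conj (z ^ k)), hzn]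
      field_simp
    rw [taylorCoeff_eq_circleAverage hφ h0 h1 k]
    have hadd := Real.circleAverage_fun_add hi1 hi2
    rw [hconj, add_zero] at hadd
    rw [← hadd]
    simp only [add_div]
  · intro z hz
    rw [Complex.add_conj, Complex.norm_real, Real.norm_of_nonneg (by linarith [hre z hz])]

/-! ### Functions with positive real part -/

/-- The squares differ by `4 * a.re * w.re`. This puts the Cayley transform `(a - w) / (a + conj w)`
in the closed unit disc. -/
theorem norm_sub_le_norm_add_conj {a w : ℂ} (ha : 0 < a.re) (hw : 0 < w.re) :
    ‖a - w‖ ≤ ‖a + conj w‖ := by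
  rw [← sq_le_sq₀ (norm_nonneg _) (norm_nonneg _), ← Complex.normSq_eq_norm_sq,
    ← Complex.normSq_eq_norm_sq, Complex.normSq_apply, Complex.normSq_apply]
  simp
  nlinarith [mul_pos ha hw]

theorem add_conj_ne_zero {a w : ℂ} (ha : 0 < a.re) (hw : 0 < w.re) : a + conj w ≠ 0 := by
  intro h
  have := congrArg Complex.re h
  simp at this
  linarith

/-- Harnack's lower bound: apply the Schwarz lemma to `(φ - 1) / (φ + 1)`. -/
theorem one_sub_norm_le_re_mul {φ : ℂ → ℂ} (hφ : DifferentiableOn ℂ φ unitDisc) (hφ0 : φ 0 = 1)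
    (hre : ∀ z ∈ unitDisc, 0 < (φ z).re) {z : ℂ} (hz : z ∈ unitDisc) :
    1 - ‖z‖ ≤ (φ z).re * (1 + ‖z‖) := by
  have h1 : (0 : ℝ) < (1 : ℂ).re := by simp
  have hne : ∀ w ∈ unitDisc, φ w + 1 ≠ 0 := fun w hw => by
    simpa using add_conj_ne_zero (hre w hw) h1
  have hz1 : ‖z‖ < 1 := mem_ball_zero_iff.1 hz
  have hs : ‖(φ z - 1) / (φ z + 1)‖ ≤ ‖z‖ := by
    refine Complex.norm_le_norm_of_mapsTo_ball (f := fun w => (φ w - 1) / (φ w + 1)) (R := 1)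
      ((hφ.sub_const 1).div (hφ.add_const 1) hne) ?_ (by simp [hφ0]) hz1
    intro w hw
    rw [mem_closedBall_zero_iff, norm_div]
    refine div_le_one_of_le₀ ?_ (norm_nonneg _)
    simpa using norm_sub_le_norm_add_conj (hre w hw) h1
  rw [norm_div, div_le_iff₀ (norm_pos_iff.2 (hne z hz))] at hs
  have hx := hre z hz
  have hsq : ‖φ z - 1‖ ^ 2 ≤ ‖z‖ ^ 2 * ‖φ z + 1‖ ^ 2 := by
    rw [← mul_pow]; gcongr
  rw [← Complex.normSq_eq_norm_sq (φ z - 1), ← Complex.normSq_eq_norm_sq (φ z + 1),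
    Complex.normSq_apply, Complex.normSq_apply] at hsq
  simp only [Complex.sub_re, Complex.sub_im, Complex.add_re, Complex.add_im, Complex.one_re,
    Complex.one_im, sub_zero, add_zero] at hsq
  have hr2 : ‖z‖ ^ 2 ≤ 1 := by nlinarith [norm_nonneg z]
  have hle : ((φ z).re - 1) ^ 2 ≤ (‖z‖ * ((φ z).re + 1)) ^ 2 := by
    nlinarith [mul_nonneg (sub_nonneg.2 hr2) (mul_self_nonneg (φ z).im)]
  have := (abs_le_of_sq_le_sq' hle (by positivity)).1
  linarith

/-- **Schwarz–Pick lemma** for the right half plane. -/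
theorem norm_deriv_mul_le_two_mul_re {φ : ℂ → ℂ} (hφ : DifferentiableOn ℂ φ unitDisc)
    (hre : ∀ z ∈ unitDisc, 0 < (φ z).re) {z : ℂ} (hz : z ∈ unitDisc) :
    ‖deriv φ z‖ * (1 - ‖z‖ ^ 2) ≤ 2 * (φ z).re := by
  have hz1 : ‖z‖ < 1 := mem_ball_zero_iff.1 hz
  -- Disc automorphism with `T 0 = z` and `T' 0 = 1 - ‖z‖ ^ 2`; it moves the estimate to the origin.
  set T : ℂ → ℂ := fun ζ => (ζ + z) / (1 + conj z * ζ) with hT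
  have hden : ∀ ζ ∈ unitDisc, 1 + conj z * ζ ≠ 0 := fun ζ hζ h => by
    have hζ1 : ‖ζ‖ < 1 := mem_ball_zero_iff.1 hζ
    have h2 := congrArg norm (eq_neg_of_add_eq_zero_right h)
    rw [norm_neg, norm_one, norm_mul, RCLike.norm_conj] at h2
    nlinarith [norm_nonneg z, norm_nonneg ζ]
  have hmaps : MapsTo T unitDisc unitDisc := fun ζ hζ => by
    have hζ1 : ‖ζ‖ < 1 := mem_ball_zero_iff.1 hζ
    rw [unitDisc, mem_ball_zero_iff, norm_div, div_lt_one (norm_pos_iff.2 (hden ζ hζ)),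
      ← sq_lt_sq₀ (norm_nonneg _) (norm_nonneg _)]
    have hid : ‖1 + conj z * ζ‖ ^ 2 - ‖ζ + z‖ ^ 2 = (1 - ‖z‖ ^ 2) * (1 - ‖ζ‖ ^ 2) := by
      simp only [← Complex.normSq_eq_norm_sq, Complex.normSq_apply]
      simp
      ring
    have : 0 < (1 - ‖z‖ ^ 2) * (1 - ‖ζ‖ ^ 2) :=
      mul_pos (by nlinarith [norm_nonneg z]) (by nlinarith [norm_nonneg ζ])
    linarith
  have hTd : DifferentiableOn ℂ T unitDisc :=
    DifferentiableOn.div (by fun_prop) (by fun_prop) hden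
  have hT0 : T 0 = z := by simp [hT]
  have hTder : HasDerivAt T (1 - (‖z‖ ^ 2 : ℝ)) 0 := by
    have h1 : HasDerivAt (fun ζ : ℂ => ζ + z) 1 0 := (hasDerivAt_id 0).add_const z
    have h2 : HasDerivAt (fun ζ : ℂ => 1 + conj z * ζ) (conj z) 0 := by
      simpa using ((hasDerivAt_id (0 : ℂ)).const_mul (conj z)).const_add 1
    have h3 := h1.div h2 (by simp)
    refine h3.congr_deriv ?_
    have : z * conj z = ((‖z‖ ^ 2 : ℝ) : ℂ) := by
      rw [Complex.mul_conj, Complex.normSq_eq_norm_sq]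
    rw [← this]; simp
  have hw := hre z hz
  set w := φ z with hwdef
  set ψ : ℂ → ℂ := fun ζ => (φ (T ζ) - w) / (φ (T ζ) + conj w) with hψ
  have hφT : DifferentiableOn ℂ (fun ζ => φ (T ζ)) unitDisc := hφ.comp hTd hmaps
  have hψd : DifferentiableOn ℂ ψ unitDisc :=
    (hφT.sub_const w).div (hφT.add_const (conj w))
      fun ζ hζ => add_conj_ne_zero (hre _ (hmaps hζ)) hw
  have hψ0 : ψ 0 = 0 := by simp [hψ, hT0, hwdef]
  have hbound : ‖deriv ψ 0‖ ≤ 1 := by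
    refine Complex.norm_deriv_le_one_of_mapsTo_ball hψd ?_ one_pos
    intro ζ hζ
    rw [hψ0, mem_closedBall_zero_iff, norm_div]
    exact div_le_one_of_le₀ (norm_sub_le_norm_add_conj (hre _ (hmaps hζ)) hw) (norm_nonneg _)
  have hφder : HasDerivAt φ (deriv φ z) (T 0) := by
    rw [hT0]; exact (hφ.differentiableAt (isOpen_unitDisc.mem_nhds hz)).hasDerivAt
  have hc : HasDerivAt (fun ζ => φ (T ζ)) (deriv φ z * (1 - (‖z‖ ^ 2 : ℝ))) 0 :=
    hφder.comp (0 : ℂ) hTder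
  have hww : w + conj w = ((2 * w.re : ℝ) : ℂ) := by rw [Complex.add_conj]
  have hne : ((2 * w.re : ℝ) : ℂ) ≠ 0 := by
    have : 2 * w.re ≠ 0 := by positivity
    exact_mod_cast this
  have hψder : HasDerivAt ψ (deriv φ z * (1 - (‖z‖ ^ 2 : ℝ)) / (2 * w.re : ℝ)) 0 := by
    have h3 := (hc.sub_const w).div (hc.add_const (conj w)) (by
      rw [hT0, ← hwdef, hww]; exact hne)
    refine h3.congr_deriv ?_
    simp only [hT0, ← hwdef, sub_self, zero_mul, sub_zero, hww]
    rw [div_eq_div_iff (pow_ne_zero 2 hne) hne]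
    ring
  rw [hψder.deriv, norm_div, norm_mul, Complex.norm_real, Real.norm_of_nonneg (by positivity),
    div_le_one (by positivity)] at hbound
  have : ‖(1 : ℂ) - (‖z‖ ^ 2 : ℝ)‖ = 1 - ‖z‖ ^ 2 := by
    rw [← Complex.ofReal_one, ← Complex.ofReal_sub, Complex.norm_real, Real.norm_of_nonneg]
    nlinarith [norm_nonneg z]
  rwa [this] at hbound

/-! ### Consequences of the defining inequality -/

theorem deriv_differentiableOn_unitDisc {f : ℂ → ℂ} (hf : DifferentiableOn ℂ f unitDisc) :
    DifferentiableOn ℂ (deriv f) unitDisc :=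
  hf.deriv isOpen_unitDisc

theorem hasDerivAt_of_unitDisc {f : ℂ → ℂ} (hf : DifferentiableOn ℂ f unitDisc) {z : ℂ}
    (hz : z ∈ unitDisc) : HasDerivAt f (deriv f z) z :=
  (hf.differentiableAt (isOpen_unitDisc.mem_nhds hz)).hasDerivAt

/-- If `Re (φ + α z φ') > 0` in the unit disc, where `α ≥ 0`, then `Re φ > 0` there. -/
theorem re_pos_of_re_add_mul_deriv_pos {φ : ℂ → ℂ} (hφ : DifferentiableOn ℂ φ unitDisc) {α : ℝ}
    (hα : 0 ≤ α) (h : ∀ z ∈ unitDisc, 0 < (φ z + α * z * deriv φ z).re) :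
    ∀ z ∈ unitDisc, 0 < (φ z).re := by
  intro z hz
  rcases hα.eq_or_lt with rfl | hα
  · simpa using h z hz
  have hz1 : ‖z‖ < 1 := mem_ball_zero_iff.1 hz
  have hmem : ∀ t ∈ Icc (0 : ℝ) 1, (t : ℂ) * z ∈ unitDisc := fun t ht => by
    rw [unitDisc, mem_ball_zero_iff, norm_mul, Complex.norm_real, Real.norm_of_nonneg ht.1]
    nlinarith [norm_nonneg z, ht.2]
  -- The power `t ^ (1 / α)` is an integrating factor: `m'` is a positive multiple of `Re (φ + α z
  -- φ')` at `t * z`, and `m 0 = 0`.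
  set m : ℝ → ℝ := fun t => t ^ (1 / α) * (φ (t * z)).re with hm
  have hcont : ContinuousOn m (Icc 0 1) := by
    refine ContinuousOn.mul ?_ ?_
    · exact (Real.continuous_rpow_const (by positivity)).continuousOn
    · refine Complex.continuous_re.comp_continuousOn (hφ.continuousOn.comp ?_ hmem)
      fun_prop
  have hder : ∀ t ∈ Ioo (0 : ℝ) 1, HasDerivAt m
      (t ^ (1 / α - 1) * α⁻¹ * (φ (t * z) + α * (t * z) * deriv φ (t * z)).re) t := by
    intro t ht
    have h1 : HasDerivAt (fun t : ℝ => t ^ (1 / α)) (1 / α * t ^ (1 / α - 1)) t :=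
      Real.hasDerivAt_rpow_const (Or.inl ht.1.ne')
    have h2 : HasDerivAt (fun t : ℝ => (t : ℂ) * z) z t := by
      simpa using (Complex.ofRealCLM.hasDerivAt (x := t)).mul_const z
    have h3 := (hasDerivAt_of_unitDisc hφ (hmem t ⟨ht.1.le, ht.2.le⟩)).comp_of_eq t h2 rfl
    have h4 := h1.mul (Complex.reCLM.hasFDerivAt.comp_hasDerivAt t h3)
    refine h4.congr_deriv ?_
    have h5 : t ^ (1 / α) = t ^ (1 / α - 1) * t := by
      rw [Real.rpow_sub_one ht.1.ne']
      field_simp [ht.1.ne']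
    have h6 : (φ (t * z) + α * (t * z) * deriv φ (t * z)).re
        = (φ (t * z)).re + α * t * (deriv φ (t * z) * z).re := by
      have : (α : ℂ) * (t * z) * deriv φ (t * z)
          = ((α * t : ℝ) : ℂ) * (deriv φ (t * z) * z) := by push_cast; ring
      rw [this, Complex.add_re, Complex.re_ofReal_mul]
    rw [h5, h6]
    simp only [Function.comp_apply, Complex.reCLM_apply]
    field_simp
  have hmono : StrictMonoOn m (Icc 0 1) := by
    refine strictMonoOn_of_deriv_pos (convex_Icc 0 1) hcont fun t ht => ?_
    rw [interior_Icc] at ht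
    rw [(hder t ht).deriv]
    have := h _ (hmem t ⟨ht.1.le, ht.2.le⟩)
    have h7 : 0 < t ^ (1 / α - 1) := Real.rpow_pos_of_pos ht.1 _
    positivity
  have := hmono (left_mem_Icc.2 zero_le_one) (right_mem_Icc.2 zero_le_one) zero_lt_one
  simpa [hm, Real.zero_rpow (inv_ne_zero hα.ne')] using this

/-- The holomorphic and antiholomorphic parts of a harmonic map are determined by the map. -/
theorem IsCanonicalDecomposition.unique {f h g h₁ g₁ : ℂ → ℂ}
    (hd : IsCanonicalDecomposition f h g) (hd₁ : IsCanonicalDecomposition f h₁ g₁) :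
    EqOn h h₁ unitDisc ∧ EqOn g g₁ unitDisc := by
  have hu : DifferentiableOn ℂ (h - h₁) unitDisc := hd.analytic_h.sub hd₁.analytic_h
  have hv : DifferentiableOn ℂ (g - g₁) unitDisc := hd.analytic_g.sub hd₁.analytic_g
  have hsum : ∀ z ∈ unitDisc, (h - h₁) z + conj ((g - g₁) z) = 0 := fun z hz => by
    have := (hd.eq_add_conj z hz).symm.trans (hd₁.eq_add_conj z hz)
    simp only [Pi.sub_apply, map_sub]
    linear_combination this
  have hder : EqOn (deriv (h - h₁)) 0 unitDisc := by
    intro z hz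
    have h1 := hasFDerivAt_add_conj (hasDerivAt_of_unitDisc hu hz) (hasDerivAt_of_unitDisc hv hz)
    have h2 : HasFDerivAt (fun z => (h - h₁) z + conj ((g - g₁) z)) (0 : ℂ →L[ℝ] ℂ) z := by
      refine (hasFDerivAt_const (0 : ℂ) z).congr_of_eventuallyEq ?_
      filter_upwards [isOpen_unitDisc.mem_nhds hz] with w hw using hsum w hw
    have h3 := h1.unique h2
    have e1 := DFunLike.congr_fun h3 1
    have e2 := DFunLike.congr_fun h3 Complex.I
    simp only [realDeriv_apply, mul_one, map_mul, Complex.conj_I, _root_.zero_apply]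
      at e1 e2
    -- Evaluating the zero real derivative at `1` and `I` separates the holomorphic part from the
    -- antiholomorphic one.
    have e3 : (deriv (h - h₁) z) * 2 = 0 := by
      linear_combination e1 - Complex.I * e2 +
        (deriv (h - h₁) z - conj (deriv (g - g₁) z)) * Complex.I_mul_I
    simpa using e3
  have h0 : (0 : ℂ) ∈ unitDisc := by simp [unitDisc]
  have hh : EqOn h h₁ unitDisc := by
    intro z hz
    have := isOpen_unitDisc.is_const_of_deriv_eq_zero
      (convex_ball (0 : ℂ) 1).isPreconnected hu hder hz h0
    simp only [Pi.sub_apply, hd.h_zero, hd₁.h_zero, sub_zero] at this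
    exact sub_eq_zero.1 this
  refine ⟨hh, fun z hz => ?_⟩
  have := hsum z hz
  simp only [Pi.sub_apply, hh hz, sub_self, zero_add, map_eq_zero] at this
  exact sub_eq_zero.1 this

/-- In the class `classWH0`, the derivatives of the two parts of `f` satisfy `‖g'‖ < Re h'`, and
are normalised. -/
theorem classWH0.deriv_bounds {α β : ℝ} (hα : 0 ≤ α) (hβ0 : 0 ≤ β) {f h g : ℂ → ℂ}
    (hf : f ∈ classWH0 α β) (hfg : IsCanonicalDecomposition f h g) :
    deriv h 0 = 1 ∧ deriv g 0 = 0 ∧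
      ∀ z ∈ unitDisc, ∀ ε : ℂ, ‖ε‖ ≤ 1 → 0 < (deriv h z + ε * deriv g z).re := by
  obtain ⟨⟨⟨_, _, hw⟩, hwb⟩, h₁, g₁, hd₁, hineq⟩ := hf
  obtain ⟨hh, hg⟩ := hfg.unique hd₁
  have h0 : (0 : ℂ) ∈ unitDisc := by simp [unitDisc]
  have hdh := hfg.analytic_h
  have hdg := hfg.analytic_g
  have hder : HasFDerivAt f (realDeriv (deriv h 0) (deriv g 0)) 0 := by
    refine (hasFDerivAt_add_conj (hasDerivAt_of_unitDisc hdh h0)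
      (hasDerivAt_of_unitDisc hdg h0)).congr_of_eventuallyEq ?_
    filter_upwards [isOpen_unitDisc.mem_nhds h0] with z hz using hfg.eq_add_conj z hz
  simp only [wirtinger, wirtingerBar, hder.fderiv, realDeriv_apply, mul_one, map_mul,
    Complex.conj_I] at hw hwb
  refine ⟨?_, ?_, ?_⟩
  · linear_combination hw + (deriv h 0 - conj (deriv g 0)) / 2 * Complex.I_mul_I
  · have : conj (deriv g 0) = 0 := by
      linear_combination hwb - (deriv h 0 - conj (deriv g 0)) / 2 * Complex.I_mul_I
    simpa using this
  have hdh' := deriv_differentiableOn_unitDisc hdh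
  have hdg' := deriv_differentiableOn_unitDisc hdg
  intro z hz ε hε
  have hφ : DifferentiableOn ℂ (fun z => deriv h z + ε * deriv g z) unitDisc :=
    hdh'.add (hdg'.const_mul ε)
  refine re_pos_of_re_add_mul_deriv_pos hφ hα (fun w hw => ?_) z hz
  have hderφ : deriv (fun z => deriv h z + ε * deriv g z) w
      = deriv (deriv h) w + ε * deriv (deriv g) w :=
    ((hasDerivAt_of_unitDisc hdh' hw).add ((hasDerivAt_of_unitDisc hdg' hw).const_mul ε)).deriv
  have hw' := hineq w hw
  have eh := (hh.eventuallyEq_of_mem (isOpen_unitDisc.mem_nhds hw))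
  have eg := (hg.eventuallyEq_of_mem (isOpen_unitDisc.mem_nhds hw))
  rw [← eh.deriv_eq, ← eg.deriv_eq, ← eh.deriv.deriv_eq, ← eg.deriv.deriv_eq] at hw'
  rw [hderφ]
  set A := deriv h w + α * w * deriv (deriv h) w with hA
  set B := deriv g w + α * w * deriv (deriv g) w with hB
  have e : deriv h w + ε * deriv g w + α * w * (deriv (deriv h) w + ε * deriv (deriv g) w)
      = A + ε * B := by rw [hA, hB]; ring
  rw [e, Complex.add_re]
  have h1 : -‖B‖ ≤ (ε * B).re := by
    have := (abs_le.1 (Complex.abs_re_le_norm (ε * B))).1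
    rw [norm_mul] at this
    nlinarith [norm_nonneg B, norm_nonneg ε]
  rw [Complex.sub_re, Complex.ofReal_re] at hw'
  linarith

/-! ### Taylor sections and tail estimates -/

theorem hasSum_congr_of_eq {E : Type*} [AddCommMonoid E] [TopologicalSpace E] {u v : ℕ → E}
    {s t : E} (hu : HasSum u s) (h : ∀ k, v k = u k) (hs : t = s) : HasSum v t := by
  rw [hs, funext h]; exact hu

theorem hasSum_taylorCoeff {f : ℂ → ℂ} (hf : DifferentiableOn ℂ f unitDisc) {z : ℂ}
    (hz : z ∈ unitDisc) : HasSum (fun k => taylorCoeff f k * z ^ k) (f z) := by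
  refine hasSum_congr_of_eq (Complex.hasSum_taylorSeries_on_ball hf hz) (fun k => ?_) rfl
  rw [taylorCoeff, smul_eq_mul, smul_eq_mul, sub_zero]
  ring

theorem taylorCoeff_zero (f : ℂ → ℂ) : taylorCoeff f 0 = f 0 := by
  simp [taylorCoeff]

theorem taylorCoeff_deriv (f : ℂ → ℂ) (k : ℕ) :
    taylorCoeff (deriv f) k = (k + 1) * taylorCoeff f (k + 1) := by
  have h1 : (k.factorial : ℂ) ≠ 0 := by exact_mod_cast k.factorial_ne_zero
  have h2 : (k + 1 : ℂ) ≠ 0 := by exact_mod_cast k.succ_ne_zero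
  rw [taylorCoeff, taylorCoeff, iteratedDeriv_succ', Nat.factorial_succ]
  push_cast
  field_simp

theorem taylorCoeff_add_const_mul {f g : ℂ → ℂ} (hf : DifferentiableOn ℂ f unitDisc)
    (hg : DifferentiableOn ℂ g unitDisc) (ε : ℂ) (k : ℕ) :
    taylorCoeff (fun z => f z + ε * g z) k = taylorCoeff f k + ε * taylorCoeff g k := by
  have h0 : unitDisc ∈ 𝓝 (0 : ℂ) := isOpen_unitDisc.mem_nhds (by simp [unitDisc])
  have h1 : ContDiffAt ℂ k f 0 := (hf.analyticAt h0).contDiffAt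
  have h2 : ContDiffAt ℂ k g 0 := (hg.analyticAt h0).contDiffAt
  rw [taylorCoeff, iteratedDeriv_fun_add h1 (contDiffAt_const.mul h2),
    iteratedDeriv_const_mul_field, taylorCoeff, taylorCoeff]
  ring

theorem hasSum_mul_deriv {f : ℂ → ℂ} (hf : DifferentiableOn ℂ f unitDisc) {z : ℂ}
    (hz : z ∈ unitDisc) : HasSum (fun k : ℕ => k * (taylorCoeff f k * z ^ k)) (z * deriv f z) := by
  rw [← hasSum_nat_add_iff' 1]
  have h := (hasSum_taylorCoeff (deriv_differentiableOn_unitDisc hf) hz).mul_left z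
  refine hasSum_congr_of_eq h (fun k => ?_) (by simp)
  rw [taylorCoeff_deriv]
  push_cast; ring

theorem differentiable_analyticSection (p : ℕ) (f : ℂ → ℂ) :
    Differentiable ℂ (analyticSection p f) := by
  unfold analyticSection; fun_prop

theorem analyticSection_eq_sum_range (p : ℕ) (f : ℂ → ℂ) :
    analyticSection p f = fun z => ∑ k ∈ Finset.range p, taylorCoeff f (k + 1) * z ^ (k + 1) := by
  ext z
  rw [analyticSection, Finset.sum_bij (fun k _ => k - 1)]
  · intro k hk; simp at hk ⊢; omega
  · intro k hk l hl; simp at hk hl ⊢; omega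
  · intro k hk; exact ⟨k + 1, by simp at hk ⊢; omega, by simp⟩
  · intro k hk
    have : k - 1 + 1 = k := by simp at hk; omega
    rw [this]

theorem deriv_analyticSection (p : ℕ) (f : ℂ → ℂ) :
    deriv (analyticSection p f) =
      fun z => ∑ k ∈ Finset.range p, taylorCoeff (deriv f) k * z ^ k := by
  ext z
  rw [analyticSection_eq_sum_range]
  have : HasDerivAt (fun z => ∑ k ∈ Finset.range p, taylorCoeff f (k + 1) * z ^ (k + 1))
      (∑ k ∈ Finset.range p, taylorCoeff (deriv f) k * z ^ k) z := by
    refine HasDerivAt.fun_sum fun k _ => ?_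
    refine ((hasDerivAt_pow (k + 1) z).const_mul _).congr_deriv ?_
    rw [taylorCoeff_deriv]
    rw [Nat.add_sub_cancel]
    push_cast; ring
  exact this.deriv

theorem mul_deriv_deriv_analyticSection (p : ℕ) (f : ℂ → ℂ) (z : ℂ) :
    z * deriv (deriv (analyticSection p f)) z =
      ∑ k ∈ Finset.range p, k * (taylorCoeff (deriv f) k * z ^ k) := by
  rw [deriv_analyticSection]
  have : HasDerivAt (fun z => ∑ k ∈ Finset.range p, taylorCoeff (deriv f) k * z ^ k)
      (∑ k ∈ Finset.range p, taylorCoeff (deriv f) k * (k * z ^ (k - 1))) z :=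
    HasDerivAt.fun_sum fun k _ => (hasDerivAt_pow k z).const_mul _
  rw [this.deriv, Finset.mul_sum]
  refine Finset.sum_congr rfl fun k _ => ?_
  rcases k with _ | k
  · simp
  · rw [Nat.add_sub_cancel]; ring

theorem hasSum_tail {E : Type*} [NormedAddCommGroup E] {u : ℕ → E} {s : E} (hu : HasSum u s)
    (p : ℕ) :
    HasSum (fun k => if k < p then 0 else u k) (s - ∑ k ∈ Finset.range p, u k) := by
  have h1 : HasSum (fun k => if k < p then u k else 0) (∑ k ∈ Finset.range p, u k) := by
    have : HasSum (fun k => if k < p then u k else 0)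
        (∑ k ∈ Finset.range p, if k < p then u k else 0) :=
      hasSum_sum_of_ne_finset_zero fun k hk => if_neg (by simpa using hk)
    refine hasSum_congr_of_eq this (fun k => rfl) (Finset.sum_congr rfl fun k hk => ?_)
    rw [if_pos (Finset.mem_range.1 hk)]
  refine hasSum_congr_of_eq (hu.sub h1) (fun k => ?_) rfl
  split_ifs <;> simp

theorem norm_le_of_hasSum {u : ℕ → ℂ} {v : ℕ → ℝ} {s : ℂ} {M : ℝ} (hu : HasSum u s)
    (hv : HasSum v M) (h : ∀ k, ‖u k‖ ≤ v k) : ‖s‖ ≤ M := by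
  rw [← hu.tsum_eq]
  exact tsum_of_norm_bounded hv h

theorem hasSum_quarter_pow : HasSum (fun k : ℕ => (1 / 4 : ℝ) ^ k) (4 / 3) := by
  have := hasSum_geometric_of_lt_one (r := (1 / 4 : ℝ)) (by norm_num) (by norm_num)
  norm_num at this ⊢
  exact this

theorem hasSum_coe_mul_quarter_pow : HasSum (fun k : ℕ => (k : ℝ) * (1 / 4) ^ k) (4 / 9) := by
  have := hasSum_coe_mul_geometric_of_norm_lt_one (r := (1 / 4 : ℝ)) (by norm_num)
  norm_num at this ⊢
  exact this

/-- The sum `2 * ∑ 4⁻ᵏ` over `k ≥ 3` is `1/24`; with weights `k` it is `5/36`, used in the next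
lemma. -/
theorem norm_tail_le {e : ℕ → ℂ} {z s : ℂ} (he : ∀ k, ‖e k‖ ≤ 2) (he0 : ∀ k < 3, e k = 0)
    (hz : ‖z‖ ≤ 1 / 4) (hs : HasSum (fun k => e k * z ^ k) s) : ‖s‖ ≤ 1 / 24 := by
  have hv := hasSum_tail (hasSum_quarter_pow.mul_left 2) 3
  norm_num [Finset.sum_range_succ] at hv
  refine (norm_le_of_hasSum hs hv fun k => ?_).trans (by norm_num)
  split_ifs with hk
  · simp [he0 k hk]
  · rw [norm_mul, norm_pow]
    have : ‖z‖ ^ k ≤ (1 / 4) ^ k := pow_le_pow_left₀ (norm_nonneg z) hz k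
    have h2 := mul_le_mul (he k) this (by positivity) (by norm_num)
    simpa using h2

theorem norm_weighted_tail_le {e : ℕ → ℂ} {z s : ℂ} (he : ∀ k, ‖e k‖ ≤ 2)
    (he0 : ∀ k < 3, e k = 0) (hz : ‖z‖ ≤ 1 / 4) (hs : HasSum (fun k : ℕ => k * (e k * z ^ k)) s) :
    ‖s‖ ≤ 5 / 36 := by
  have hv := hasSum_tail (hasSum_coe_mul_quarter_pow.mul_left 2) 3
  norm_num [Finset.sum_range_succ] at hv
  refine (norm_le_of_hasSum hs hv fun k => ?_).trans (by norm_num)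
  split_ifs with hk
  · simp [he0 k hk]
  · rw [norm_mul, norm_mul, norm_pow, Complex.norm_natCast]
    have : ‖z‖ ^ k ≤ (1 / 4) ^ k := pow_le_pow_left₀ (norm_nonneg z) hz k
    have h2 := mul_le_mul (he k) this (by positivity) (by norm_num)
    have h3 := mul_le_mul_of_nonneg_left h2 (Nat.cast_nonneg (α := ℝ) k)
    calc _ ≤ _ := h3
      _ = _ := by norm_num; ring

/-- Test with `ε = -conj b / ‖b‖`. -/
theorem norm_lt_re_of_forall_re_pos {a b : ℂ} (h : ∀ ε : ℂ, ‖ε‖ ≤ 1 → 0 < (a + ε * b).re) :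
    ‖b‖ < a.re := by
  rcases eq_or_ne b 0 with rfl | hb
  · simpa using h 0 (by simp)
  have hb' : (‖b‖ : ℂ) ≠ 0 := by simpa using hb
  have h1 := h (-(conj b / ‖b‖)) (by
    rw [norm_neg, norm_div, RCLike.norm_conj, Complex.norm_real, norm_norm,
      div_self (norm_ne_zero_iff.2 hb)])
  have h2 : -(conj b / ‖b‖) * b = ((-‖b‖ : ℝ) : ℂ) := by
    have : conj b * b = (‖b‖ : ℂ) ^ 2 := by
      rw [mul_comm, Complex.mul_conj, Complex.normSq_eq_norm_sq]; push_cast; rfl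
    rw [neg_mul, div_mul_eq_mul_div, this]
    push_cast
    field_simp
  rw [h2, Complex.add_re, Complex.ofReal_re] at h1
  linarith

/-! ### Sections on the disc of radius `1/4` -/

section Sections

variable {h g : ℂ → ℂ} {z ε : ℂ}

/-- Comparison of the sections of order at least three with the map itself on `‖z‖ ≤ 1 / 4`. -/
theorem section_bounds_of_three_le (hh : DifferentiableOn ℂ h unitDisc)
    (hg : DifferentiableOn ℂ g unitDisc) (hh0 : deriv h 0 = 1) (hg0 : deriv g 0 = 0)
    (hre : ∀ z ∈ unitDisc, ∀ ε : ℂ, ‖ε‖ ≤ 1 → 0 < (deriv h z + ε * deriv g z).re)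
    {p q : ℕ} (hp : 3 ≤ p) (hq : 3 ≤ q) (hz : ‖z‖ ≤ 1 / 4) (hε : ‖ε‖ ≤ 1) :
    0 < (deriv (analyticSection p h) z + ε * deriv (analyticSection q g) z).re ∧
    ‖z * (deriv (deriv (analyticSection p h)) z + ε * deriv (deriv (analyticSection q g)) z)‖ <
      ‖deriv (analyticSection p h) z + ε * deriv (analyticSection q g) z‖ := by
  have hzD : z ∈ unitDisc := by rw [unitDisc, mem_ball_zero_iff]; linarith
  have hh' := deriv_differentiableOn_unitDisc hh
  have hg' := deriv_differentiableOn_unitDisc hg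
  set φ : ℂ → ℂ := fun z => deriv h z + ε * deriv g z with hφdef
  have hφ : DifferentiableOn ℂ φ unitDisc := hh'.add (hg'.const_mul ε)
  have hφ0 : φ 0 = 1 := by simp [hφdef, hh0, hg0]
  have hφre : ∀ z ∈ unitDisc, 0 < (φ z).re := fun z hz => hre z hz ε hε
  have hh're : ∀ z ∈ unitDisc, ‖deriv g z‖ < (deriv h z).re := fun z hz =>
    norm_lt_re_of_forall_re_pos fun ε hε => hre z hz ε hε
  set c := taylorCoeff (deriv h) with hc
  set d := taylorCoeff (deriv g) with hd
  have hcb : ∀ k ≠ 0, ‖c k‖ ≤ 2 := fun k hk =>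
    norm_taylorCoeff_le_two hh' hh0 (fun z hz => (norm_nonneg _).trans_lt (hh're z hz)) hk
  have hdb : ∀ k, ‖d k‖ ≤ 1 := norm_taylorCoeff_le_one hg' hh' hh0 fun z hz => (hh're z hz).le
  have hcd : ∀ k ≠ 0, ‖c k + ε * d k‖ ≤ 2 := fun k hk => by
    rw [hc, hd, ← taylorCoeff_add_const_mul hh' hg']
    exact norm_taylorCoeff_le_two hφ hφ0 hφre hk
  -- Coefficients of `φ - S`. Where both tails are present the bound `2` comes from `h' + ε g'` as a
  -- whole; separate bounds would give only `3`.
  set e : ℕ → ℂ := fun k => (if k < p then 0 else c k) + ε * (if k < q then 0 else d k) with he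
  have heb : ∀ k, ‖e k‖ ≤ 2 := fun k => by
    have hεd : ‖ε * d k‖ ≤ 1 := by
      rw [norm_mul]; exact mul_le_one₀ hε (norm_nonneg _) (hdb k)
    by_cases h1 : k < p <;> by_cases h2 : k < q
    · simp [he, h1, h2]
    · simp only [he, h1, h2, if_true, if_false, zero_add]; linarith
    · simp only [he, h1, h2, if_true, if_false, mul_zero, add_zero]
      exact hcb k (by omega)
    · simp only [he, h1, h2, if_false]
      exact hcd k (by omega)
  have he0 : ∀ k < 3, e k = 0 := fun k hk => by
    simp [he, hk.trans_le hp, hk.trans_le hq]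
  set S := deriv (analyticSection p h) z + ε * deriv (analyticSection q g) z with hS
  set S' := z * (deriv (deriv (analyticSection p h)) z +
    ε * deriv (deriv (analyticSection q g)) z) with hS'
  have hsum : HasSum (fun k => e k * z ^ k) (φ z - S) := by
    have h1 := hasSum_tail (hasSum_taylorCoeff hh' hzD) p
    have h2 := hasSum_tail (hasSum_taylorCoeff hg' hzD) q
    refine hasSum_congr_of_eq (h1.add (h2.mul_left ε)) (fun k => ?_) ?_
    · simp only [he]
      split_ifs <;> ring
    · simp only [hS, deriv_analyticSection, hφdef]; ring
  have hsum' : HasSum (fun k : ℕ => k * (e k * z ^ k)) (z * deriv φ z - S') := by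
    have h1 := hasSum_tail (hasSum_mul_deriv hh' hzD) p
    have h2 := hasSum_tail (hasSum_mul_deriv hg' hzD) q
    have h3 : deriv φ z = deriv (deriv h) z + ε * deriv (deriv g) z :=
      ((hasDerivAt_of_unitDisc hh' hzD).add ((hasDerivAt_of_unitDisc hg' hzD).const_mul ε)).deriv
    refine hasSum_congr_of_eq (h1.add (h2.mul_left ε)) (fun k => ?_) ?_
    · simp only [he]
      split_ifs <;> ring
    · rw [← mul_deriv_deriv_analyticSection, ← mul_deriv_deriv_analyticSection, h3]; ring
  have hE := norm_tail_le heb he0 hz hsum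
  have hE' := norm_weighted_tail_le heb he0 hz hsum'
  have hlow := one_sub_norm_le_re_mul hφ hφ0 hφre hzD
  have hpick := norm_deriv_mul_le_two_mul_re hφ hφre hzD
  have hpos := hφre z hzD
  have hz0 := norm_nonneg z
  have hre35 : 3 / 5 ≤ (φ z).re := by nlinarith
  have hder : ‖z * deriv φ z‖ ≤ 8 / 15 * (φ z).re := by
    rw [norm_mul]
    have hD := norm_nonneg (deriv φ z)
    have h16 : 15 / 16 ≤ 1 - ‖z‖ ^ 2 := by nlinarith
    have h17 : ‖deriv φ z‖ * (15 / 16) ≤ 2 * (φ z).re :=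
      (mul_le_mul_of_nonneg_left h16 hD).trans hpick
    nlinarith
  have hEre := (abs_le.1 ((Complex.abs_re_le_norm (φ z - S)).trans hE)).2
  rw [Complex.sub_re] at hEre
  have hSn := (le_abs_self S.re).trans (Complex.abs_re_le_norm S)
  have hS'n : ‖S'‖ ≤ ‖z * deriv φ z‖ + ‖z * deriv φ z - S'‖ := by
    have := norm_sub_le (z * deriv φ z) (z * deriv φ z - S')
    rwa [sub_sub_cancel] at this
  -- The second claim needs `(7/15) * Re φ > 1/24 + 5/36 = 13/72`, and `Re φ ≥ 3/5` makes the left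
  -- side at least `7/25`.
  exact ⟨by linarith, by linarith⟩

theorem norm_sum_range_le {d : ℕ → ℂ} (hd : ∀ k, ‖d k‖ ≤ 1) (hd0 : d 0 = 0) (q : ℕ)
    (hz : ‖z‖ ≤ 1 / 4) :
    ‖∑ k ∈ Finset.range q, d k * z ^ k‖ ≤ 1 / 3 ∧
      ‖∑ k ∈ Finset.range q, (k : ℂ) * (d k * z ^ k)‖ ≤ 4 / 9 := by
  have hterm : ∀ k, ‖d k * z ^ k‖ ≤ (1 / 4) ^ k := fun k => by
    rw [norm_mul, norm_pow]
    have : ‖z‖ ^ k ≤ (1 / 4) ^ k := pow_le_pow_left₀ (norm_nonneg z) hz k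
    simpa using mul_le_mul (hd k) this (by positivity) zero_le_one
  constructor
  · have hv := hasSum_tail hasSum_quarter_pow 1
    norm_num at hv
    refine (norm_sum_le _ _).trans ((Finset.sum_le_sum fun k _ => ?_).trans
      (sum_le_hasSum (Finset.range q) (fun k _ => ?_) hv))
    · split_ifs with hk
      · simp [hk, hd0]
      · simpa using hterm k
    · split_ifs <;> positivity
  · refine (norm_sum_le _ _).trans ((Finset.sum_le_sum fun k _ => ?_).trans
      (sum_le_hasSum (Finset.range q) (fun k _ => ?_) hasSum_coe_mul_quarter_pow))
    · rw [norm_mul, Complex.norm_natCast]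
      exact mul_le_mul_of_nonneg_left (hterm k) (Nat.cast_nonneg k)
    · positivity

/-- Here the analytic section has derivative `1`, so the comparison is `4/9 < 1 - 1/3`. -/
theorem section_bounds_of_one (hh : DifferentiableOn ℂ h unitDisc)
    (hg : DifferentiableOn ℂ g unitDisc) (hh0 : deriv h 0 = 1) (hg0 : deriv g 0 = 0)
    (hre : ∀ z ∈ unitDisc, ‖deriv g z‖ < (deriv h z).re)
    (q : ℕ) (hz : ‖z‖ ≤ 1 / 4) (hε : ‖ε‖ ≤ 1) :
    0 < (deriv (analyticSection 1 h) z + ε * deriv (analyticSection q g) z).re ∧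
    ‖z * (deriv (deriv (analyticSection 1 h)) z + ε * deriv (deriv (analyticSection q g)) z)‖ <
      ‖deriv (analyticSection 1 h) z + ε * deriv (analyticSection q g) z‖ := by
  have hdb : ∀ k, ‖taylorCoeff (deriv g) k‖ ≤ 1 :=
    norm_taylorCoeff_le_one (deriv_differentiableOn_unitDisc hg)
      (deriv_differentiableOn_unitDisc hh) hh0 fun z hz => (hre z hz).le
  obtain ⟨h1, h2⟩ := norm_sum_range_le hdb (by rw [taylorCoeff_zero, hg0]) q hz
  rw [mul_add, mul_left_comm, mul_deriv_deriv_analyticSection, mul_deriv_deriv_analyticSection,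
    deriv_analyticSection, deriv_analyticSection]
  simp only [Finset.sum_range_one, Nat.cast_zero, zero_add, pow_zero, mul_one,
    taylorCoeff_zero, hh0]
  set A := ∑ k ∈ Finset.range q, taylorCoeff (deriv g) k * z ^ k
  set B := ∑ k ∈ Finset.range q, (k : ℂ) * (taylorCoeff (deriv g) k * z ^ k)
  have hA : ‖ε * A‖ ≤ 1 / 3 := by
    rw [norm_mul]; nlinarith [norm_nonneg A, norm_nonneg ε]
  have hB : ‖ε * B‖ ≤ 4 / 9 := by
    rw [norm_mul]; nlinarith [norm_nonneg B, norm_nonneg ε]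
  have h3 := (abs_le.1 ((Complex.abs_re_le_norm (ε * A)).trans hA)).1
  have h4 : 2 / 3 ≤ (1 + ε * A).re := by
    rw [Complex.add_re, Complex.one_re]; linarith
  have h5 := (le_abs_self (1 + ε * A).re).trans (Complex.abs_re_le_norm _)
  exact ⟨by linarith, by linarith⟩

end Sections

end HarmonicMap

theorem mainTheorem9 (α β : ℝ) (hα : 0 ≤ α) (hβ0 : 0 ≤ β) (hβ1 : β < 1)
    (f h g : ℂ → ℂ) (hf : f ∈ HarmonicMap.classWH0 α β)
    (hfg : HarmonicMap.IsCanonicalDecomposition f h g)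
    (p q : ℕ) (hpq : (1 = p ∧ p < q) ∨ (3 ≤ p ∧ p < q) ∨ (3 ≤ q ∧ q < p)) :
    HarmonicMap.IsConvexInDisc (HarmonicMap.partialSum p q h g) (1 / 4) := by
  obtain ⟨hh0, hg0, hre⟩ := HarmonicMap.classWH0.deriv_bounds hα hβ0 hf hfg
  have hh := hfg.analytic_h
  have hg := hfg.analytic_g
  have key : ∀ z ∈ Metric.ball (0 : ℂ) (1 / 4), ∀ ε : ℂ, ‖ε‖ ≤ 1 →
      0 < (deriv (HarmonicMap.analyticSection p h) z +
        ε * deriv (HarmonicMap.analyticSection q g) z).re ∧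
      ‖z * (deriv (deriv (HarmonicMap.analyticSection p h)) z +
        ε * deriv (deriv (HarmonicMap.analyticSection q g)) z)‖ <
      ‖deriv (HarmonicMap.analyticSection p h) z +
        ε * deriv (HarmonicMap.analyticSection q g) z‖ := by
    intro z hz ε hε
    have hz' : ‖z‖ ≤ 1 / 4 := (mem_ball_zero_iff.1 hz).le
    rcases hpq with ⟨rfl, _⟩ | ⟨hp, hlt⟩ | ⟨hq, hlt⟩
    · exact HarmonicMap.section_bounds_of_one hh hg hh0 hg0
        (fun w hw => HarmonicMap.norm_lt_re_of_forall_re_pos fun ε hε => hre w hw ε hε) q hz' hε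
    · exact HarmonicMap.section_bounds_of_three_le hh hg hh0 hg0 hre hp (hp.trans hlt.le) hz' hε
    · exact HarmonicMap.section_bounds_of_three_le hh hg hh0 hg0 hre (hq.trans hlt.le) hq hz' hε
  exact HarmonicMap.isConvexInDisc_add_conj
    (HarmonicMap.differentiable_analyticSection p h)
    (HarmonicMap.differentiable_analyticSection q g)
    (fun z hz => HarmonicMap.norm_lt_re_of_forall_re_pos fun ε hε => (key z hz ε hε).1)
    (fun z hz ε hε => (key z hz ε hε.le).2)
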